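/- All graphs are finite and simple. A complex unit gain graph $G^{\varphi}$ is a graph $G$ together with a function $\varphi$ from the oriented edges of $G$ (each edge $uv$ gives two, $\overrightarrow{uv}$ and $\overrightarrow{vu}$) to the unit circle $\{z\in\mathbb{C}:|z|=1\}$ such that $\varphi(\overrightarrow{uv})=\varphi(\overrightarrow{vu})^{-1}$. Its adjacency matrix $A(G^{\varphi})$ is the Hermitian matrix indexed by $V(G)$ whose $(u,v)$ entry is $\varphi(\overrightarrow{uv})$ if $uv\in E(G)$ and $0$ otherwise, and $n(G^{\varphi})$ denotes the number of negative eigenvalues of $A(G^{\varphi})$, counted with multiplicity. Let $m(H)$ be the maximum number of edges in a matching of a graph $H$, and let $c(G)=|E(G)|-|V(G)|+\omega(G)$, where $\omega(G)$ is the number of connected components of $G$. A cycle $v_1v_2\cdots v_kv_1$ ($k\ge 3$) of $G$ is of Type A if $k$ is even and $\varphi(\overrightarrow{v_1v_2})\varphi(\overrightarrow{v_2v_3})\cdots\varphi(\overrightarrow{v_{k-1}v_k})\varphi(\overrightarrow{v_kv_1})=(-1)^{k/2}$. Let $O(G)$ be the set of vertices of $G$ lying on cycles, and let $G-O(G)$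 be the graph obtained from $G$ by deleting these vertices. If the cycles of $G$ are pairwise vertex-disjoint, let $T_G$ be the acyclic graph obtained from $G$ by contracting each cycle into a single vertex. **Theorem 3.11.** Let $G^{\varphi}$ be a connected complex unit gain graph. Then $n(G^{\varphi})=m(G)-c(G)$ if and only if the following three conditions all hold: (a) any two distinct cycles of $G$ have no common vertex; (b) every cycle of $G^{\varphi}$ is of Type A; (c) $m(T_G)=m(G-O(G))$. -/

import Mathlib

namespace SimpleGraph

variable {V : Type*}

/-- The matching number `m(G)`: the largest number of edges of a matching of `G`
(used for graphs with finitely many vertices). -/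
noncomputable def matchingNumber (G : SimpleGraph V) : ℕ :=
  sSup {k : ℕ | ∃ M : G.Subgraph, M.IsMatching ∧ M.edgeSet.ncard = k}

/-- The cyclomatic number `c(G) = |E(G)| - |V(G)| + ω(G)`, where `ω(G)` is the number of
connected components (used for graphs with finitely many vertices). -/
noncomputable def cyclomaticNumber (G : SimpleGraph V) : ℤ :=
  (G.edgeSet.ncard : ℤ) - (Nat.card V : ℤ) + (Nat.card G.ConnectedComponent : ℤ)

/-- The cycles of `G`, as subgraphs of `G`: those traversed by a closed walk that is a cycle. -/
def cycleSubgraphs (G : SimpleGraph V) : Set G.Subgraph :=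
  {C | ∃ (v : V) (w : G.Walk v v), w.IsCycle ∧ w.toSubgraph = C}

/-- Any two distinct cycles of `G` have no common vertex. -/
def CyclesVertexDisjoint (G : SimpleGraph V) : Prop :=
  G.cycleSubgraphs.PairwiseDisjoint Subgraph.verts

/-- `O(G)`: the set of the vertices that lie on some cycle of `G`. -/
def cycleVertices (G : SimpleGraph V) : Set V :=
  {v | ∃ C ∈ G.cycleSubgraphs, v ∈ C.verts}

/-- The vertices `u` and `v` lie on a common cycle of `G`. -/
def OnCommonCycle (G : SimpleGraph V) (u v : V) : Prop :=
  ∃ C ∈ G.cycleSubgraphs, u ∈ C.verts ∧ v ∈ C.verts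

/-- `T_G`: the simple graph obtained from `G` by contracting each cycle of `G` into one vertex.
Its vertices are the classes of vertices of `G` modulo identification of vertices on a common
cycle; two distinct classes are adjacent when some edge of `G` joins them. -/
def cycleContraction (G : SimpleGraph V) : SimpleGraph (Quot G.OnCommonCycle) :=
  G.map (Quot.mk G.OnCommonCycle)

end SimpleGraph

/-- A complex unit gain graph on the vertex set `V`: a simple graph together with a map from its
oriented edges to the circle group that takes inverse values on the two orientations of an edge. -/
structure UnitGainGraph (V : Type*) where
  /-- The underlying graph. -/
  graph : SimpleGraph V
  /-- The gain function. -/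
  gain : graph.Dart → Circle
  gain_symm : ∀ d : graph.Dart, gain d.symm = (gain d)⁻¹

namespace UnitGainGraph

variable {V : Type*}

open Classical in
/-- The adjacency matrix: the `(u, v)` entry is the gain of the oriented edge from `u` to `v` if
`u` and `v` are adjacent, and `0` otherwise. -/
noncomputable def adjMatrix (Φ : UnitGainGraph V) : Matrix V V ℂ :=
  Matrix.of fun u v => if h : Φ.graph.Adj u v then (Φ.gain ⟨(u, v), h⟩ : ℂ) else 0

theorem adjMatrix_isHermitian (Φ : UnitGainGraph V) : Φ.adjMatrix.IsHermitian := by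
  ext u v
  by_cases h : Φ.graph.Adj u v
  · have hs : Φ.gain ⟨(v, u), h.symm⟩ = (Φ.gain ⟨(u, v), h⟩)⁻¹ := Φ.gain_symm ⟨(u, v), h⟩
    simp only [Matrix.conjTranspose_apply, adjMatrix, Matrix.of_apply, dif_pos h, dif_pos h.symm, hs,
      Circle.coe_inv_eq_conj]
    simp
  · have h' : ¬ Φ.graph.Adj v u := fun k => h k.symm
    simp [adjMatrix, h, h']

/-- The negative inertia index: the number of negative eigenvalues of the adjacency matrix,
counted with multiplicity. -/
noncomputable def negInertia [Fintype V] [DecidableEq V] (Φ : UnitGainGraph V) : ℕ :=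
  Nat.card {i : V // Φ.adjMatrix_isHermitian.eigenvalues i < 0}

/-- The gain of a walk: the product of the gains of its consecutive oriented edges. -/
noncomputable def walkGain (Φ : UnitGainGraph V) {u v : V} (w : Φ.graph.Walk u v) : Circle :=
  (w.darts.map Φ.gain).prod

/-- Type A, for a closed walk running once around a cycle of length `n`:
`n` is even and the gain of the cycle is `(-1)^(n/2)`. -/
def IsTypeA (Φ : UnitGainGraph V) {v : V} (w : Φ.graph.Walk v v) : Prop :=
  Even w.length ∧ (Φ.walkGain w : ℂ) = (-1) ^ (w.length / 2)

/-- Every cycle is of Type A. (Gain `±1` depends neither on the starting vertex nor on the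
direction in which the cycle is traversed.) -/
def CyclesTypeA (Φ : UnitGainGraph V) : Prop :=
  ∀ (v : V) (w : Φ.graph.Walk v v), w.IsCycle → Φ.IsTypeA w

end UnitGainGraph

/-!
Write `n`, `m`, `c` for the negative inertia index, the matching number and the cyclomatic number.
Always `m ≤ n + c`: deleting a vertex of a cycle lowers `m` by at most one, `c` by at least one and
does not raise `n`, while deleting a pendant vertex with its neighbour lowers `n` by at least one
and `m` by at most one; this reduces to edgeless graphs. If equality holds, it persists under these
deletions, and each of them changes `m` and `c` by the least amount possible. Hence distinct cycles
are disjoint, equality passes to each cycle, and a cycle attaining it is of Type A.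

Condition (c) amounts, by König's theorem in the forest `T_G`, to the existence of a vertex set
which avoids the cycles, covers the edges lying on no cycle and is no larger than a matching of
`G - O(G)`. Under equality such a cover is built by induction on `G`, removing a pendant pair or
one vertex of a cycle attached to the rest by a single edge. Conversely such a cover `K` gives
`n + c ≤ |K| + |O(G)| / 2 ≤ m(G - O(G)) + |O(G)| / 2 ≤ m`, since a Type A cycle of length `k` has
at most `k / 2 - 1` negative eigenvalues, each vertex of `K` contributes at most one more, and the
even cycles have perfect matchings.
-/

open Matrix SimpleGraph

section NegativeIndex

variable {𝕜 V W : Type*} [RCLike 𝕜] [Fintype V] [Fintype W]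

/-- The real part of the sesquilinear form of a square matrix on the diagonal; for a Hermitian
matrix this is the associated quadratic form. -/
noncomputable def reForm (A : Matrix V V 𝕜) (f : V → 𝕜) : ℝ :=
  RCLike.re (star f ⬝ᵥ A *ᵥ f)

theorem reForm_zero (A : Matrix V V 𝕜) : reForm A 0 = 0 := by
  simp [reForm]

theorem reForm_add (A B : Matrix V V 𝕜) (f : V → 𝕜) :
    reForm (A + B) f = reForm A f + reForm B f := by
  simp [reForm, add_mulVec, dotProduct_add]

theorem reForm_conjTranspose_mul_mul (A : Matrix V V 𝕜) (B : Matrix V W 𝕜) (f : W → 𝕜) :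
    reForm (Bᴴ * A * B) f = reForm A (B *ᵥ f) := by
  simp only [reForm, star_mulVec, ← mulVec_mulVec, dotProduct_mulVec, vecMul_vecMul]

/-- The negative index of inertia of a square matrix, as the largest dimension of a subspace on
which its form is negative definite. -/
noncomputable def negIndex (A : Matrix V V 𝕜) : ℕ :=
  sSup {d | ∃ U : Submodule 𝕜 (V → 𝕜), Module.finrank 𝕜 U = d ∧
    ∀ f ∈ U, f ≠ 0 → reForm A f < 0}

theorem bddAbove_finrank_neg (A : Matrix V V 𝕜) :
    BddAbove {d | ∃ U : Submodule 𝕜 (V → 𝕜), Module.finrank 𝕜 U = d ∧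
      ∀ f ∈ U, f ≠ 0 → reForm A f < 0} := by
  refine ⟨Module.finrank 𝕜 (V → 𝕜), ?_⟩
  rintro d ⟨U, rfl, -⟩
  exact Submodule.finrank_le U

theorem finrank_le_negIndex {A : Matrix V V 𝕜} {U : Submodule 𝕜 (V → 𝕜)}
    (h : ∀ f ∈ U, f ≠ 0 → reForm A f < 0) : Module.finrank 𝕜 U ≤ negIndex A :=
  le_csSup (bddAbove_finrank_neg A) ⟨U, rfl, h⟩

theorem exists_finrank_eq_negIndex (A : Matrix V V 𝕜) :
    ∃ U : Submodule 𝕜 (V → 𝕜), Module.finrank 𝕜 U = negIndex A ∧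
      ∀ f ∈ U, f ≠ 0 → reForm A f < 0 :=
  Nat.sSup_mem
    (s := {d | ∃ U : Submodule 𝕜 (V → 𝕜), Module.finrank 𝕜 U = d ∧
      ∀ f ∈ U, f ≠ 0 → reForm A f < 0})
    ⟨0, ⊥, finrank_bot 𝕜 _, fun _ hf h => absurd ((Submodule.mem_bot 𝕜).1 hf) h⟩
    (bddAbove_finrank_neg A)

theorem finrank_le_negIndex_of_linearMap {E : Type*} [AddCommGroup E] [Module 𝕜 E]
    {A : Matrix V V 𝕜} (L : E →ₗ[𝕜] (V → 𝕜)) (h : ∀ g, g ≠ 0 → reForm A (L g) < 0) :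
    Module.finrank 𝕜 E ≤ negIndex A := by
  have hinj : Function.Injective L := by
    refine (injective_iff_map_eq_zero L).2 fun g hg => by_contra fun h0 => ?_
    simpa [hg, reForm_zero] using h g h0
  rw [← LinearMap.finrank_range_of_inj hinj]
  refine finrank_le_negIndex ?_
  rintro _ ⟨g, rfl⟩ hg
  exact h g fun h0 => hg (by rw [h0, map_zero])

theorem negIndex_le_finrank_of_ker {E : Type*} [AddCommGroup E] [Module 𝕜 E]
    [FiniteDimensional 𝕜 E] {A : Matrix V V 𝕜} (L : (V → 𝕜) →ₗ[𝕜] E)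
    (h : ∀ f, L f = 0 → 0 ≤ reForm A f) : negIndex A ≤ Module.finrank 𝕜 E := by
  obtain ⟨U, hU, hneg⟩ := exists_finrank_eq_negIndex A
  rw [← hU]
  refine LinearMap.finrank_le_finrank_of_injective (f := L ∘ₗ U.subtype)
    ((injective_iff_map_eq_zero _).2 fun f hf => by_contra fun h0 => ?_)
  exact absurd (hneg f f.2 (by simpa using h0)) (not_lt.2 (h f hf))

theorem card_le_negIndex_add_finrank_of_ker {E : Type*} [AddCommGroup E] [Module 𝕜 E]
    [FiniteDimensional 𝕜 E] {A : Matrix V V 𝕜} (L : (V → 𝕜) →ₗ[𝕜] E)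
    (h : ∀ f, L f = 0 → f ≠ 0 → reForm A f < 0) :
    Fintype.card V ≤ negIndex A + Module.finrank 𝕜 E := by
  have hker : Module.finrank 𝕜 (LinearMap.ker L) ≤ negIndex A :=
    finrank_le_negIndex fun f hf => h f (LinearMap.mem_ker.1 hf)
  have hrange := Submodule.finrank_le (LinearMap.range L)
  have hsum := L.finrank_range_add_finrank_ker
  rw [Module.finrank_pi] at hsum
  lia

theorem negIndex_conjTranspose_mul_mul_le (A : Matrix V V 𝕜) (B : Matrix V W 𝕜) :
    negIndex (Bᴴ * A * B) ≤ negIndex A := by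
  obtain ⟨U, hU, hneg⟩ := exists_finrank_eq_negIndex (Bᴴ * A * B)
  rw [← hU]
  refine finrank_le_negIndex_of_linearMap (B.mulVecLin ∘ₗ U.subtype) fun g hg => ?_
  have hform := reForm_conjTranspose_mul_mul A B g
  exact hform ▸ hneg g g.2 (by simpa using hg)

section Eigenvalues

variable [DecidableEq V]

theorem reForm_eq_sum_eigenvalues {A : Matrix V V 𝕜} (hA : A.IsHermitian) (f : V → 𝕜) :
    reForm A f = ∑ i, hA.eigenvalues i *
      ‖((hA.eigenvectorUnitary : Matrix V V 𝕜)ᴴ *ᵥ f) i‖ ^ 2 := by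
  have hspec : A = (hA.eigenvectorUnitary : Matrix V V 𝕜)ᴴᴴ *
      diagonal (RCLike.ofReal ∘ hA.eigenvalues) * (hA.eigenvectorUnitary : Matrix V V 𝕜)ᴴ := by
    conv_lhs => rw [hA.spectral_theorem, Unitary.conjStarAlgAut_apply]
    rw [conjTranspose_conjTranspose, star_eq_conjTranspose]
  conv_lhs => rw [hspec]
  rw [reForm_conjTranspose_mul_mul]
  simp only [reForm, dotProduct, mulVec_diagonal, map_sum, Pi.star_apply, Function.comp_apply,
    RCLike.star_def, mul_left_comm _ (RCLike.ofReal _ : 𝕜), RCLike.conj_mul]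
  refine Finset.sum_congr rfl fun i _ => ?_
  norm_cast

theorem eq_zero_of_eigenvectorUnitary_conjTranspose_mulVec_eq_zero {A : Matrix V V 𝕜}
    (hA : A.IsHermitian) {f : V → 𝕜}
    (h : (hA.eigenvectorUnitary : Matrix V V 𝕜)ᴴ *ᵥ f = 0) : f = 0 := by
  have := congrArg ((hA.eigenvectorUnitary : Matrix V V 𝕜) *ᵥ ·) h
  simpa [mulVec_mulVec, ← star_eq_conjTranspose] using this

/-- The coordinates of a vector along the eigenvectors whose eigenvalue satisfies `p`. -/
noncomputable def eigenCoords {A : Matrix V V 𝕜} (hA : A.IsHermitian) (p : ℝ → Prop) :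
    (V → 𝕜) →ₗ[𝕜] ({i // p (hA.eigenvalues i)} → 𝕜) :=
  LinearMap.funLeft 𝕜 𝕜 Subtype.val ∘ₗ (hA.eigenvectorUnitary : Matrix V V 𝕜)ᴴ.mulVecLin

theorem eigenCoords_eq_zero_iff {A : Matrix V V 𝕜} (hA : A.IsHermitian) (p : ℝ → Prop)
    (f : V → 𝕜) : eigenCoords hA p f = 0 ↔
      ∀ i, p (hA.eigenvalues i) → ((hA.eigenvectorUnitary : Matrix V V 𝕜)ᴴ *ᵥ f) i = 0 := by
  simp [eigenCoords, funext_iff, LinearMap.funLeft_apply]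

theorem reForm_nonneg_of_eigenCoords_eq_zero {A : Matrix V V 𝕜} (hA : A.IsHermitian)
    {f : V → 𝕜} (hf : eigenCoords hA (· < 0) f = 0) : 0 ≤ reForm A f := by
  rw [reForm_eq_sum_eigenvalues hA]
  rw [eigenCoords_eq_zero_iff] at hf
  refine Finset.sum_nonneg fun i _ => ?_
  rcases lt_or_ge (hA.eigenvalues i) 0 with hi | hi
  · simp [hf i hi]
  · positivity

theorem reForm_neg_of_eigenCoords_eq_zero {A : Matrix V V 𝕜} (hA : A.IsHermitian)
    {f : V → 𝕜} (hf : eigenCoords hA (¬ · < 0) f = 0) (h0 : f ≠ 0) : reForm A f < 0 := by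
  rw [eigenCoords_eq_zero_iff] at hf
  obtain ⟨j, hj⟩ := Function.ne_iff.1
    (mt (eq_zero_of_eigenvectorUnitary_conjTranspose_mulVec_eq_zero hA) h0)
  rw [reForm_eq_sum_eigenvalues hA]
  refine Finset.sum_neg' (fun i _ => ?_) ⟨j, Finset.mem_univ j, ?_⟩
  · rcases lt_or_ge (hA.eigenvalues i) 0 with hi | hi
    · exact mul_nonpos_of_nonpos_of_nonneg hi.le (by positivity)
    · simp [hf i (not_lt.2 hi)]
  · exact mul_neg_of_neg_of_pos (not_not.1 fun hn => hj (hf j hn)) (pow_pos (norm_pos_iff.2 hj) 2)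

theorem negIndex_eq_card_eigenvalues_neg {A : Matrix V V 𝕜} (hA : A.IsHermitian) :
    negIndex A = Fintype.card {i // hA.eigenvalues i < 0} := by
  have hle := negIndex_le_finrank_of_ker (eigenCoords hA (· < 0))
    fun _ => reForm_nonneg_of_eigenCoords_eq_zero hA
  have hge := card_le_negIndex_add_finrank_of_ker (eigenCoords hA (¬ · < 0))
    fun _ => reForm_neg_of_eigenCoords_eq_zero hA
  rw [Module.finrank_pi] at hle hge
  have hcompl := Fintype.card_subtype_compl (hA.eigenvalues · < 0)
  have hcard := Fintype.card_subtype_le (hA.eigenvalues · < 0)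
  lia

end Eigenvalues

theorem negIndex_add_le {A B : Matrix V V 𝕜} (hA : A.IsHermitian) (hB : B.IsHermitian) :
    negIndex (A + B) ≤ negIndex A + negIndex B := by
  classical
  rw [negIndex_eq_card_eigenvalues_neg hA, negIndex_eq_card_eigenvalues_neg hB,
    ← Module.finrank_pi 𝕜, ← Module.finrank_pi 𝕜, ← Module.finrank_prod]
  refine negIndex_le_finrank_of_ker ((eigenCoords hA (· < 0)).prod (eigenCoords hB (· < 0)))
    fun f hf => ?_
  obtain ⟨hfA, hfB⟩ := Prod.mk.inj hf
  rw [reForm_add]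
  exact add_nonneg (reForm_nonneg_of_eigenCoords_eq_zero hA hfA)
    (reForm_nonneg_of_eigenCoords_eq_zero hB hfB)

end NegativeIndex

section Matching

variable {V W : Type*} {G H : SimpleGraph V} {M N : Finset (Sym2 V)}

/-- A matching of `G`, encoded as a finite set of pairwise disjoint edges, so that matchings of
different graphs on the same vertex type can be compared, filtered and united. -/
def IsEdgeMatching (G : SimpleGraph V) (M : Finset (Sym2 V)) : Prop :=
  (∀ e ∈ M, e ∈ G.edgeSet) ∧ ∀ e ∈ M, ∀ f ∈ M, ∀ v, v ∈ e → v ∈ f → e = f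

namespace IsEdgeMatching

theorem empty (G : SimpleGraph V) : IsEdgeMatching G ∅ := by
  simp [IsEdgeMatching]

theorem mono (hM : IsEdgeMatching G M) (hle : G ≤ H) : IsEdgeMatching H M :=
  ⟨fun e he => edgeSet_mono hle (hM.1 e he), hM.2⟩

theorem subset (hM : IsEdgeMatching G M) (hN : N ⊆ M) : IsEdgeMatching G N :=
  ⟨fun e he => hM.1 e (hN he), fun e he f hf => hM.2 e (hN he) f (hN hf)⟩

theorem union [DecidableEq V] (hM : IsEdgeMatching G M) (hN : IsEdgeMatching G N)
    (h : ∀ e ∈ M, ∀ f ∈ N, ∀ v, v ∈ e → v ∉ f) : IsEdgeMatching G (M ∪ N) := by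
  refine ⟨fun e he => (Finset.mem_union.1 he).elim (hM.1 e) (hN.1 e),
    fun e he f hf v hve hvf => ?_⟩
  rcases Finset.mem_union.1 he with he | he <;> rcases Finset.mem_union.1 hf with hf | hf
  · exact hM.2 e he f hf v hve hvf
  · exact absurd hvf (h e he f hf v hve)
  · exact absurd hve (h f hf e he v hvf)
  · exact hN.2 e he f hf v hve hvf

theorem card_union [DecidableEq V] (h : ∀ e ∈ M, ∀ f ∈ N, ∀ v, v ∈ e → v ∉ f) :
    (M ∪ N).card = M.card + N.card := by
  refine Finset.card_union_of_disjoint (Finset.disjoint_left.2 fun e heM heN => ?_)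
  exact h e heM e heN _ e.out_fst_mem e.out_fst_mem

theorem card_le_of_cover (hM : IsEdgeMatching G M) {K : Finset V}
    (h : ∀ e ∈ M, ∃ v ∈ K, v ∈ e) : M.card ≤ K.card := by
  rcases M.eq_empty_or_nonempty with rfl | ⟨e₀, -⟩
  · simp
  have : Nonempty V := ⟨e₀.out.1⟩
  choose! f hfK hfe using h
  refine Finset.card_le_card_of_injOn f hfK fun e he e' he' hee => ?_
  exact hM.2 e he e' he' (f e) (hfe e he) (hee ▸ hfe e' he')

theorem two_mul_card_le (hM : IsEdgeMatching G M) {S : Finset V}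
    (h : ∀ e ∈ M, ∀ v ∈ e, v ∈ S) : 2 * M.card ≤ S.card := by
  classical
  have hdisj : (M : Set (Sym2 V)).PairwiseDisjoint Sym2.toFinset := by
    intro e he f hf hef
    refine Finset.disjoint_left.2 fun v hve hvf => hef ?_
    exact hM.2 e he f hf v (Sym2.mem_toFinset.1 hve) (Sym2.mem_toFinset.1 hvf)
  calc 2 * M.card = ∑ e ∈ M, e.toFinset.card := by
        rw [Finset.sum_congr rfl fun e he => Sym2.card_toFinset_of_not_isDiag e
          (G.not_isDiag_of_mem_edgeSet (hM.1 e he)), Finset.sum_const, smul_eq_mul, mul_comm]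
    _ = (M.biUnion Sym2.toFinset).card := (Finset.card_biUnion hdisj).symm
    _ ≤ S.card := Finset.card_le_card fun v hv => by
        obtain ⟨e, he, hve⟩ := Finset.mem_biUnion.1 hv
        exact h e he v (Sym2.mem_toFinset.1 hve)

section Image

variable {G' : SimpleGraph W} {f : V → W} {S : Set V}

theorem eq_of_mem_map (hM : IsEdgeMatching G M) (hS : ∀ e ∈ M, ∀ v ∈ e, v ∈ S)
    (hf : Set.InjOn f S) {e e' : Sym2 V} (he : e ∈ M) (he' : e' ∈ M) {w : W}
    (hw : w ∈ Sym2.map f e) (hw' : w ∈ Sym2.map f e') : e = e' := by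
  obtain ⟨v, hv, rfl⟩ := Sym2.mem_map.1 hw
  obtain ⟨v', hv', hvv⟩ := Sym2.mem_map.1 hw'
  obtain rfl := hf (hS e' he' v' hv') (hS e he v hv) hvv
  exact hM.2 e he e' he' _ hv hv'

theorem image [DecidableEq W] (hM : IsEdgeMatching G M) (hS : ∀ e ∈ M, ∀ v ∈ e, v ∈ S)
    (hf : Set.InjOn f S)
    (hadj : ∀ u v, s(u, v) ∈ M → G'.Adj (f u) (f v)) :
    IsEdgeMatching G' (M.image (Sym2.map f)) := by
  simp only [IsEdgeMatching, Finset.forall_mem_image]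
  refine ⟨fun e he => ?_, fun e he e' he' w hw hw' => by rw [hM.eq_of_mem_map hS hf he he' hw hw']⟩
  induction e with
  | h u v => exact hadj u v he

theorem card_image [DecidableEq W] (hM : IsEdgeMatching G M) (hS : ∀ e ∈ M, ∀ v ∈ e, v ∈ S)
    (hf : Set.InjOn f S) : (M.image (Sym2.map f)).card = M.card :=
  Finset.card_image_of_injOn fun _ he _ he' hee =>
    have hw := Sym2.out_fst_mem (Sym2.map f _)
    hM.eq_of_mem_map hS hf he he' hw (hee ▸ hw)

end Image

theorem exists_isMatching (hM : IsEdgeMatching G M) :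
    ∃ N : G.Subgraph, N.IsMatching ∧ N.edgeSet.ncard = M.card := by
  refine ⟨⟨{v | ∃ e ∈ M, v ∈ e}, fun u v => s(u, v) ∈ M, fun h => hM.1 _ h,
    fun h => ⟨_, h, Sym2.mem_mk_left _ _⟩, ⟨fun u v h => by rwa [Sym2.eq_swap]⟩⟩, ?_, ?_⟩
  · rintro v ⟨e, he, hve⟩
    obtain ⟨w, rfl⟩ := Sym2.mem_iff_exists.1 hve
    exact ⟨w, he, fun w' hw' =>
      (Sym2.congr_right.1 (hM.2 _ he _ hw' v hve (Sym2.mem_mk_left _ _))).symm⟩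
  · rw [← Set.ncard_coe_finset]
    congr 1
    ext e
    induction e with
    | h u v => rfl

variable [Finite V]

theorem exists_of_isMatching {N : G.Subgraph} (hN : N.IsMatching) :
    ∃ M, IsEdgeMatching G M ∧ M.card = N.edgeSet.ncard := by
  refine ⟨N.edgeSet.toFinite.toFinset, ⟨fun e he => ?_, fun e he f hf v hve hvf => ?_⟩,
    (Set.ncard_eq_toFinset_card _).symm⟩
  · exact N.edgeSet_subset ((Set.Finite.mem_toFinset _).1 he)
  · rw [Set.Finite.mem_toFinset] at he hf
    obtain ⟨w, rfl⟩ := Sym2.mem_iff_exists.1 hve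
    obtain ⟨w', rfl⟩ := Sym2.mem_iff_exists.1 hvf
    rw [hN.eq_of_adj_left (Subgraph.mem_edgeSet.1 he) (Subgraph.mem_edgeSet.1 hf)]

theorem bddAbove (G : SimpleGraph V) :
    BddAbove {k : ℕ | ∃ M : G.Subgraph, M.IsMatching ∧ M.edgeSet.ncard = k} := by
  refine ⟨G.edgeSet.ncard, ?_⟩
  rintro k ⟨M, -, rfl⟩
  exact Set.ncard_le_ncard M.edgeSet_subset (Set.toFinite _)

theorem card_le (hM : IsEdgeMatching G M) : M.card ≤ G.matchingNumber :=
  le_csSup (bddAbove G) hM.exists_isMatching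

end IsEdgeMatching

section Finite

variable [Finite V]

theorem exists_isEdgeMatching (G : SimpleGraph V) :
    ∃ M, IsEdgeMatching G M ∧ M.card = G.matchingNumber := by
  have hne : {k : ℕ | ∃ M : G.Subgraph, M.IsMatching ∧ M.edgeSet.ncard = k}.Nonempty :=
    (IsEdgeMatching.empty G).exists_isMatching.imp' _ fun _ hN => ⟨_, hN⟩
  obtain ⟨N, hN, hcard⟩ := Nat.sSup_mem hne (IsEdgeMatching.bddAbove G)
  obtain ⟨M, hM, hMN⟩ := IsEdgeMatching.exists_of_isMatching hN
  exact ⟨M, hM, hMN.trans hcard⟩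

theorem matchingNumber_le {n : ℕ} (h : ∀ M, IsEdgeMatching G M → M.card ≤ n) :
    G.matchingNumber ≤ n := by
  obtain ⟨M, hM, hcard⟩ := exists_isEdgeMatching G
  exact hcard ▸ h M hM

theorem matchingNumber_mono (h : G ≤ H) : G.matchingNumber ≤ H.matchingNumber :=
  matchingNumber_le fun _ hM => (hM.mono h).card_le

theorem matchingNumber_le_card_of_isVertexCover {K : Finset V} (hK : G.IsVertexCover K) :
    G.matchingNumber ≤ K.card := by
  refine matchingNumber_le fun M hM => hM.card_le_of_cover fun e he => ?_
  have hadj := hM.1 e he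
  induction e with
  | h u v =>
    rcases hK hadj with hu | hv
    exacts [⟨u, hu, Sym2.mem_mk_left _ _⟩, ⟨v, hv, Sym2.mem_mk_right _ _⟩]

theorem matchingNumber_bot : (⊥ : SimpleGraph V).matchingNumber = 0 := by
  refine Nat.le_zero.1 (matchingNumber_le fun M hM => ?_)
  rw [Nat.le_zero, Finset.card_eq_zero, Finset.eq_empty_iff_forall_notMem]
  exact fun e he => by simpa using hM.1 e he

end Finite

/-- The spanning subgraph of `G` in which the vertices of `S` have been made isolated: it stands
for the vertex deletion `G - S` without changing the vertex type. -/
def isolate (G : SimpleGraph V) (S : Set V) : SimpleGraph V where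
  Adj u v := G.Adj u v ∧ u ∉ S ∧ v ∉ S
  symm := ⟨fun _ _ h => ⟨h.1.symm, h.2.2, h.2.1⟩⟩
  loopless := ⟨fun _ h => h.1.ne rfl⟩

@[simp]
theorem isolate_adj {S : Set V} {u v : V} :
    (isolate G S).Adj u v ↔ G.Adj u v ∧ u ∉ S ∧ v ∉ S := Iff.rfl

theorem isolate_le (G : SimpleGraph V) (S : Set V) : isolate G S ≤ G := fun _ _ h => h.1

theorem isolate_lt {S : Set V} {u v : V} (h : G.Adj u v) (hu : u ∈ S) : isolate G S < G :=
  (isolate_le G S).lt_of_not_ge fun hle => (hle h).2.1 hu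

theorem mem_edgeSet_isolate {S : Set V} {e : Sym2 V} :
    e ∈ (isolate G S).edgeSet ↔ e ∈ G.edgeSet ∧ ∀ v ∈ e, v ∉ S := by
  induction e with
  | h u v => simp

theorem isolate_isolate (G : SimpleGraph V) (S T : Set V) :
    isolate (isolate G S) T = isolate G (S ∪ T) := by
  ext u v
  simp only [isolate_adj, Set.mem_union]
  tauto

theorem le_isolate_iff {S : Set V} : H ≤ isolate G S ↔ H ≤ G ∧ Disjoint H.support S := by
  refine ⟨fun h => ⟨h.trans (isolate_le G S), Set.disjoint_left.2 ?_⟩, fun h u v huv => ?_⟩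
  · rintro u ⟨v, huv⟩
    exact (h huv).2.1
  · exact ⟨h.1 huv, Set.disjoint_left.1 h.2 ⟨v, huv⟩, Set.disjoint_left.1 h.2 ⟨u, huv.symm⟩⟩

variable [Finite V]

theorem matchingNumber_le_isolate_add {S : Set V} {K : Finset V}
    (h : ∀ u v, G.Adj u v → u ∈ S → u ∈ K ∨ v ∈ K) :
    G.matchingNumber ≤ (isolate G S).matchingNumber + K.card := by
  classical
  refine matchingNumber_le fun M hM => ?_
  rw [← Finset.card_filter_add_card_filter_not (s := M) (fun e => ∀ v ∈ e, v ∉ S)]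
  apply add_le_add
  · refine IsEdgeMatching.card_le ⟨fun e he => ?_, (hM.subset (Finset.filter_subset _ _)).2⟩
    rw [Finset.mem_filter] at he
    exact mem_edgeSet_isolate.2 ⟨hM.1 e he.1, he.2⟩
  · refine (hM.subset (Finset.filter_subset _ _)).card_le_of_cover fun e he => ?_
    rw [Finset.mem_filter] at he
    obtain ⟨he, hn⟩ := he
    push Not at hn
    obtain ⟨u, hu, huS⟩ := hn
    obtain ⟨v, rfl⟩ := Sym2.mem_iff_exists.1 hu
    rcases h u v (hM.1 _ he) huS with hk | hk
    · exact ⟨u, hk, Sym2.mem_mk_left _ _⟩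
    · exact ⟨v, hk, Sym2.mem_mk_right _ _⟩

theorem two_mul_matchingNumber_le_isolate_add {S : Set V} {K : Finset V}
    (h : ∀ u v, G.Adj u v → u ∈ S → u ∈ K ∧ v ∈ K) :
    2 * G.matchingNumber ≤ 2 * (isolate G S).matchingNumber + K.card := by
  classical
  obtain ⟨M, hM, hcard⟩ := exists_isEdgeMatching G
  rw [← hcard, ← Finset.card_filter_add_card_filter_not (s := M) (fun e => ∀ v ∈ e, v ∉ S),
    mul_add]
  apply add_le_add
  · refine Nat.mul_le_mul_left 2 (IsEdgeMatching.card_le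
      ⟨fun e he => ?_, (hM.subset (Finset.filter_subset _ _)).2⟩)
    rw [Finset.mem_filter] at he
    exact mem_edgeSet_isolate.2 ⟨hM.1 e he.1, he.2⟩
  · refine (hM.subset (Finset.filter_subset _ _)).two_mul_card_le fun e he v hv => ?_
    rw [Finset.mem_filter] at he
    obtain ⟨he, hn⟩ := he
    push Not at hn
    obtain ⟨u, hu, huS⟩ := hn
    obtain ⟨w, rfl⟩ := Sym2.mem_iff_exists.1 hu
    rcases Sym2.mem_iff.1 hv with rfl | rfl
    exacts [(h _ w (hM.1 _ he) huS).1, (h u _ (hM.1 _ he) huS).2]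

theorem matchingNumber_le_isolate_singleton (G : SimpleGraph V) (x : V) :
    G.matchingNumber ≤ (isolate G {x}).matchingNumber + 1 :=
  matchingNumber_le_isolate_add (K := {x}) fun _ _ _ hu => Or.inl (Finset.mem_singleton.2 hu)

theorem matchingNumber_le_isolate_pendant {x y : V} (hx : ∀ v, G.Adj x v → v = y) :
    G.matchingNumber ≤ (isolate G {x, y}).matchingNumber + 1 := by
  refine matchingNumber_le_isolate_add (K := {y}) fun u v huv hu => ?_
  rcases hu with rfl | rfl
  · exact Or.inr (Finset.mem_singleton.2 (hx v huv))
  · exact Or.inl (Finset.mem_singleton_self _)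

theorem matchingNumber_isolate_pair_add_one_le {x y : V} (hxy : G.Adj x y) :
    (isolate G {x, y}).matchingNumber + 1 ≤ G.matchingNumber := by
  classical
  obtain ⟨M, hM, hcard⟩ := exists_isEdgeMatching (isolate G {x, y})
  have hedge : IsEdgeMatching G {s(x, y)} := by
    simp [IsEdgeMatching, hxy]
  have hdisj : ∀ e ∈ M, ∀ f ∈ ({s(x, y)} : Finset (Sym2 V)), ∀ v, v ∈ e → v ∉ f := by
    intro e he f hf v hve hvf
    rw [Finset.mem_singleton.1 hf, Sym2.mem_iff] at hvf
    exact (mem_edgeSet_isolate.1 (hM.1 e he)).2 v hve hvf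
  have hle := ((hM.mono (isolate_le _ _)).union hedge hdisj).card_le
  rwa [IsEdgeMatching.card_union hdisj, hcard, Finset.card_singleton] at hle

theorem matchingNumber_induce_compl (G : SimpleGraph V) (S : Set V) :
    (G.induce Sᶜ).matchingNumber = (isolate G S).matchingNumber := by
  classical
  refine le_antisymm (matchingNumber_le fun M hM => ?_) (matchingNumber_le fun M hM => ?_)
  · have huniv : ∀ e ∈ M, ∀ v ∈ e, v ∈ Set.univ := fun _ _ _ _ => Set.mem_univ _
    have hinj := Subtype.val_injective.injOn (s := (Set.univ : Set ↥(Sᶜ : Set V)))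
    rw [← hM.card_image huniv hinj]
    exact (hM.image (G' := isolate G S) huniv hinj fun u v h => ⟨hM.1 _ h, u.2, v.2⟩).card_le
  · let f : Sym2 ↥(Sᶜ : Set V) → Sym2 V := Sym2.map Subtype.val
    have hf : Function.Injective f := Sym2.map.injective Subtype.val_injective
    have hrange : ∀ e ∈ M, e ∈ Set.range f := fun e he => by
      have hadj := hM.1 e he
      induction e with
      | h u v => exact ⟨s(⟨u, hadj.2.1⟩, ⟨v, hadj.2.2⟩), rfl⟩
    have hcard : (M.preimage f hf.injOn).card = M.card := by
      rw [Finset.card_preimage, Finset.filter_true_of_mem hrange]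
    rw [← hcard]
    refine IsEdgeMatching.card_le ⟨fun e he => ?_, fun e he e' he' v hv hv' => ?_⟩
    · have hadj := hM.1 _ (Finset.mem_preimage.1 he)
      induction e with
      | h u v => exact hadj.1
    · exact hf (hM.2 _ (Finset.mem_preimage.1 he) _ (Finset.mem_preimage.1 he') v.1
        (Sym2.mem_map.2 ⟨v, hv, rfl⟩) (Sym2.mem_map.2 ⟨v, hv', rfl⟩))

end Matching

section Cycles

variable {V : Type*} {G H C C' : SimpleGraph V}

/-- `C` is the edge set of a single cycle, the vertices off the cycle being isolated: a cycle of
`H` is encoded as a spanning subgraph `C ≤ H` with this property. -/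
def IsCycleGraph (C : SimpleGraph V) : Prop :=
  ∃ (v : V) (w : C.Walk v v), w.IsCycle ∧ ∀ e ∈ C.edgeSet, e ∈ w.edges

theorem mem_of_reachable_of_forall_adj {S : Set V} {u v : V} (h : G.Reachable u v)
    (hu : u ∈ S) (hS : ∀ a ∈ S, ∀ b, G.Adj a b → b ∈ S) : v ∈ S := by
  obtain ⟨w⟩ := h
  induction w with
  | nil => exact hu
  | cons hab _ ih => exact ih (hS _ hu _ hab)

namespace IsCycleGraph

theorem exists_adj (hC : IsCycleGraph C) : ∃ x y, C.Adj x y := by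
  obtain ⟨x, w, hw, -⟩ := hC
  exact ⟨x, w.snd, w.adj_snd hw.not_nil⟩

theorem of_isCycle {v : V} {w : G.Walk v v} (hw : w.IsCycle) :
    IsCycleGraph w.toSubgraph.spanningCoe := by
  have hedge : ∀ e, e ∈ w.toSubgraph.spanningCoe.edgeSet ↔ e ∈ w.edges := fun e => by
    rw [Subgraph.edgeSet_spanningCoe, w.mem_edges_toSubgraph]
  have htransfer : ∀ e ∈ w.edges, e ∈ w.toSubgraph.spanningCoe.edgeSet := fun e => (hedge e).2
  refine ⟨v, w.transfer _ htransfer, hw.transfer htransfer, fun e he => ?_⟩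
  rw [Walk.edges_transfer]
  exact (hedge e).1 he

theorem exists_walk (hC : IsCycleGraph C) (hle : C ≤ H) :
    ∃ (x : V) (w : H.Walk x x), w.IsCycle ∧ w.toSubgraph.spanningCoe = C := by
  obtain ⟨x, w, hw, h⟩ := hC
  refine ⟨x, w.mapLe hle, hw.mapLe hle, ?_⟩
  ext u v
  rw [Subgraph.spanningCoe_adj, Walk.adj_toSubgraph_mapLe, Walk.adj_toSubgraph_iff_mem_edges]
  exact ⟨w.adj_of_mem_edges, fun huv => h s(u, v) huv⟩

theorem reachable (hC : IsCycleGraph C) {u v : V} (hu : u ∈ C.support) (hv : v ∈ C.support) :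
    C.Reachable u v := by
  classical
  obtain ⟨x, w, -, h⟩ := hC
  have hbase : ∀ u ∈ C.support, C.Reachable x u := by
    rintro u ⟨z, hz⟩
    exact ⟨w.takeUntil u (w.fst_mem_support_of_mem_edges (h s(u, z) hz))⟩
  exact (hbase u hu).symm.trans (hbase v hv)

theorem not_isBridge (hC : IsCycleGraph C) {u v : V} (h : C.Adj u v) :
    ¬ C.IsBridge s(u, v) := by
  obtain ⟨x, w, hw, he⟩ := hC
  exact fun hb => hb.notMem_edges_of_isCycle hw (he _ h)

theorem not_isBridge_of_mem_support (hC : IsCycleGraph C) (hle : C ≤ H) {u v : V}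
    (hu : u ∈ C.support) (hv : v ∈ C.support) : ¬ H.IsBridge s(u, v) := by
  by_cases huv : C.Adj u v
  · exact fun hb => hC.not_isBridge huv (hb.anti hle)
  · refine not_not.2 ((hC.reachable hu hv).mono fun a b hab => deleteEdges_adj.2 ⟨hle hab, ?_⟩)
    exact fun he => huv ((C.adj_congr_of_sym2 he).1 hab)

theorem le_of_forall_adj (hC : IsCycleGraph C) {x : V} (hx : x ∈ C.support)
    (hx' : x ∈ C'.support)
    (h : ∀ v, v ∈ C.support → v ∈ C'.support → ∀ u, C.Adj v u → C'.Adj v u) : C ≤ C' := by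
  have hsub : ∀ v ∈ C.support, v ∈ C'.support := fun v hv =>
    (mem_of_reachable_of_forall_adj (S := {v | v ∈ C.support ∧ v ∈ C'.support})
      (hC.reachable hx hv) ⟨hx, hx'⟩
      fun a ha b hab => ⟨⟨a, hab.symm⟩, ⟨a, (h a ha.1 ha.2 b hab).symm⟩⟩).2
  exact fun u v huv => h u ⟨v, huv⟩ (hsub u ⟨v, huv⟩) v huv

end IsCycleGraph

theorem not_isBridge_iff_exists_isCycleGraph {u v : V} (h : H.Adj u v) :
    ¬ H.IsBridge s(u, v) ↔ ∃ C ≤ H, IsCycleGraph C ∧ C.Adj u v := by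
  constructor
  · intro hb
    rw [isBridge_iff, not_not] at hb
    obtain ⟨x, w, hw, he⟩ := adj_and_reachable_delete_edges_iff_exists_cycle.1 ⟨h, hb⟩
    exact ⟨_, w.toSubgraph.spanningCoe_le, .of_isCycle hw, w.mem_edges_toSubgraph.2 he⟩
  · rintro ⟨C, hle, hC, huv⟩ hb
    exact hC.not_isBridge huv (hb.anti hle)

theorem exists_isCycleGraph_of_not_isAcyclic (h : ¬ H.IsAcyclic) : ∃ C ≤ H, IsCycleGraph C := by
  rw [isAcyclic_iff_forall_adj_isBridge] at h
  push Not at h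
  obtain ⟨u, v, huv, hb⟩ := h
  obtain ⟨C, hle, hC, -⟩ := (not_isBridge_iff_exists_isCycleGraph huv).1 hb
  exact ⟨C, hle, hC⟩

/-- The cycles of `H`, encoded as spanning subgraphs, are pairwise vertex-disjoint. -/
def DisjointCycles (H : SimpleGraph V) : Prop :=
  ∀ C ≤ H, ∀ C' ≤ H, IsCycleGraph C → IsCycleGraph C' →
    ∀ v ∈ C.support, v ∈ C'.support → C = C'

theorem DisjointCycles.mono (h : DisjointCycles H) (hle : G ≤ H) : DisjointCycles G :=
  fun C hC C' hC' => h C (hC.trans hle) C' (hC'.trans hle)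

theorem mem_support_spanningCoe_iff_of_isCycle {x v : V} {w : G.Walk x x} (hw : w.IsCycle) :
    v ∈ w.toSubgraph.spanningCoe.support ↔ v ∈ w.toSubgraph.verts := by
  classical
  refine ⟨fun ⟨u, hu⟩ => Subgraph.Adj.fst_mem hu, fun hv => ?_⟩
  rw [Walk.mem_verts_toSubgraph] at hv
  have hadj := (w.rotate v hv).toSubgraph_adj_snd ((Walk.isCycle_rotate hv).2 hw).not_nil
  rw [Walk.toSubgraph_rotate] at hadj
  exact ⟨_, hadj⟩

theorem onCommonCycle_iff {u v : V} :
    H.OnCommonCycle u v ↔ ∃ C ≤ H, IsCycleGraph C ∧ u ∈ C.support ∧ v ∈ C.support := by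
  constructor
  · rintro ⟨_, ⟨x, w, hw, rfl⟩, hu, hv⟩
    exact ⟨_, w.toSubgraph.spanningCoe_le, .of_isCycle hw,
      (mem_support_spanningCoe_iff_of_isCycle hw).2 hu,
      (mem_support_spanningCoe_iff_of_isCycle hw).2 hv⟩
  · rintro ⟨C, hle, hC, hu, hv⟩
    obtain ⟨x, w, hw, rfl⟩ := hC.exists_walk hle
    exact ⟨_, ⟨x, w, hw, rfl⟩, (mem_support_spanningCoe_iff_of_isCycle hw).1 hu,
      (mem_support_spanningCoe_iff_of_isCycle hw).1 hv⟩

theorem mem_cycleVertices_iff {v : V} :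
    v ∈ H.cycleVertices ↔ ∃ C ≤ H, IsCycleGraph C ∧ v ∈ C.support := by
  have h : v ∈ H.cycleVertices ↔ H.OnCommonCycle v v :=
    ⟨fun ⟨C, hC, hv⟩ => ⟨C, hC, hv, hv⟩, fun ⟨C, hC, hv, _⟩ => ⟨C, hC, hv⟩⟩
  rw [h, onCommonCycle_iff]
  simp only [and_self]

theorem cyclesVertexDisjoint_iff : H.CyclesVertexDisjoint ↔ DisjointCycles H := by
  constructor
  · intro h C hC C' hC' hc hc' v hv hv'
    obtain ⟨x, w, hw, rfl⟩ := hc.exists_walk hC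
    obtain ⟨x', w', hw', rfl⟩ := hc'.exists_walk hC'
    rw [mem_support_spanningCoe_iff_of_isCycle hw] at hv
    rw [mem_support_spanningCoe_iff_of_isCycle hw'] at hv'
    by_contra hne
    exact Set.disjoint_left.1 (h ⟨x, w, hw, rfl⟩ ⟨x', w', hw', rfl⟩
      fun heq => hne (congrArg _ heq)) hv hv'
  · rintro h _ ⟨x, w, hw, rfl⟩ _ ⟨x', w', hw', rfl⟩ hne
    refine Set.disjoint_left.2 fun v hv hv' => hne ?_
    have heq := h _ w.toSubgraph.spanningCoe_le _ w'.toSubgraph.spanningCoe_le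
      (.of_isCycle hw) (.of_isCycle hw') v
      ((mem_support_spanningCoe_iff_of_isCycle hw).2 hv)
      ((mem_support_spanningCoe_iff_of_isCycle hw').2 hv')
    ext u v
    · rw [← mem_support_spanningCoe_iff_of_isCycle hw, heq,
        mem_support_spanningCoe_iff_of_isCycle hw']
    · rw [← Subgraph.spanningCoe_adj, heq, Subgraph.spanningCoe_adj]

end Cycles

section EdgeDeletion

variable {V : Type*} {G H : SimpleGraph V} {x y : V}

theorem reachable_deleteEdges_or {u v : V} (h : H.Reachable u v) :
    (H.deleteEdges {s(x, y)}).Reachable u v ∨ (H.deleteEdges {s(x, y)}).Reachable u x ∨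
      (H.deleteEdges {s(x, y)}).Reachable u y := by
  obtain ⟨w⟩ := h
  induction w with
  | nil => exact Or.inl (Reachable.refl _)
  | @cons a b c hab _ ih =>
    by_cases he : s(a, b) = s(x, y)
    · rcases Sym2.eq_iff.1 he with ⟨rfl, -⟩ | ⟨rfl, -⟩
      · exact Or.inr (Or.inl (Reachable.refl _))
      · exact Or.inr (Or.inr (Reachable.refl _))
    · have hab' : (H.deleteEdges {s(x, y)}).Reachable a b :=
        Adj.reachable (deleteEdges_adj.2 ⟨hab, he⟩)
      exact ih.imp hab'.trans (Or.imp hab'.trans hab'.trans)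

theorem reachable_deleteEdges_of_not_isBridge (hb : ¬ H.IsBridge s(x, y)) {u v : V}
    (h : H.Reachable u v) : (H.deleteEdges {s(x, y)}).Reachable u v := by
  rw [isBridge_iff, not_not] at hb
  have hor : ∀ {u v}, H.Reachable u v → (H.deleteEdges {s(x, y)}).Reachable u v ∨
      (H.deleteEdges {s(x, y)}).Reachable u x := fun h =>
    (reachable_deleteEdges_or h).imp_right (Or.elim · id (·.trans hb.symm))
  rcases hor h with huv | hux
  · exact huv
  rcases hor h.symm with hvu | hvx
  · exact hvu.symm
  · exact hux.trans hvx.symm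

theorem deleteEdges_singleton_lt (h : H.Adj x y) : H.deleteEdges {s(x, y)} < H :=
  (deleteEdges_le _).lt_of_not_ge fun hle => (deleteEdges_adj.1 (hle h)).2 rfl

theorem le_deleteEdges_singleton (hle : G ≤ H) (h : ¬ G.Adj x y) :
    G ≤ H.deleteEdges {s(x, y)} := by
  intro u v huv
  refine deleteEdges_adj.2 ⟨hle huv, fun he => h ?_⟩
  have he : s(u, v) = s(x, y) := he
  rwa [← mem_edgeSet, ← he]

theorem exists_adj_not_adj_of_lt (h : G < H) : ∃ x y, H.Adj x y ∧ ¬ G.Adj x y := by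
  by_contra! hcon
  exact not_le_of_gt h fun x y => hcon x y

theorem card_connectedComponent_deleteEdges_of_not_isBridge (hb : ¬ H.IsBridge s(x, y)) :
    Nat.card (H.deleteEdges {s(x, y)}).ConnectedComponent = Nat.card H.ConnectedComponent := by
  have hle : H.deleteEdges {s(x, y)} ≤ H := deleteEdges_le _
  refine Nat.card_eq_of_bijective (ConnectedComponent.map (Hom.ofLE hle))
    ⟨fun c c' hcc => ?_, ConnectedComponent.surjective_map_ofLE hle⟩
  induction c using ConnectedComponent.ind with | h u =>
  induction c' using ConnectedComponent.ind with | h v =>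
  rw [ConnectedComponent.map_mk, ConnectedComponent.map_mk, ConnectedComponent.eq] at hcc
  exact ConnectedComponent.eq.2 (reachable_deleteEdges_of_not_isBridge hb hcc)

theorem cyclomaticNumber_bot : (⊥ : SimpleGraph V).cyclomaticNumber = 0 := by
  have h : Nat.card V = Nat.card (⊥ : SimpleGraph V).ConnectedComponent :=
    Nat.card_eq_of_bijective (⊥ : SimpleGraph V).connectedComponentMk
      ⟨fun u v huv => reachable_bot.1 (ConnectedComponent.eq.1 huv), Quot.mk_surjective⟩
  simp [cyclomaticNumber, h]

section CyclomaticNumber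

variable [Finite V]

theorem card_connectedComponent_deleteEdges_le (H : SimpleGraph V) (x y : V) :
    Nat.card (H.deleteEdges {s(x, y)}).ConnectedComponent ≤
      Nat.card H.ConnectedComponent + 1 := by
  classical
  let c₀ := (H.deleteEdges {s(x, y)}).connectedComponentMk x
  -- Two components other than that of `x` which merge in `H` both contain `y`.
  rw [← Finite.card_option]
  refine Nat.card_le_card_of_injective (fun c => if c = c₀ then none else
    some (c.map (Hom.ofLE (deleteEdges_le _)))) fun c c' hcc => ?_
  by_cases h : c = c₀ <;> by_cases h' : c' = c₀
  · rw [h, h']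
  · simp [h, h'] at hcc
  · simp [h, h'] at hcc
  · induction c using ConnectedComponent.ind with | h u =>
    induction c' using ConnectedComponent.ind with | h v =>
    simp only [h, h', if_false, Option.some.injEq, ConnectedComponent.map_mk, Hom.ofLE_apply,
      ConnectedComponent.eq] at hcc
    rw [ConnectedComponent.eq] at h h' ⊢
    rcases reachable_deleteEdges_or (x := x) (y := y) hcc with huv | hux | huy
    · exact huv
    · exact absurd hux h
    rcases reachable_deleteEdges_or (x := x) (y := y) hcc.symm with hvu | hvx | hvy
    · exact hvu.symm
    · exact absurd hvx h'
    · exact huy.trans hvy.symm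

theorem card_connectedComponent_deleteEdges_of_isBridge (h : H.Adj x y)
    (hb : H.IsBridge s(x, y)) :
    Nat.card (H.deleteEdges {s(x, y)}).ConnectedComponent =
      Nat.card H.ConnectedComponent + 1 := by
  classical
  refine le_antisymm (card_connectedComponent_deleteEdges_le H x y) ?_
  have hle : H.deleteEdges {s(x, y)} ≤ H := deleteEdges_le _
  let _ := Fintype.ofFinite H.ConnectedComponent
  let _ := Fintype.ofFinite (H.deleteEdges {s(x, y)}).ConnectedComponent
  rw [Nat.card_eq_fintype_card, Nat.card_eq_fintype_card]
  refine Fintype.card_lt_of_surjective_not_injective _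
    (ConnectedComponent.surjective_map_ofLE hle) fun hinj => hb (ConnectedComponent.eq.1 (hinj ?_))
  rw [ConnectedComponent.map_mk, ConnectedComponent.map_mk, ConnectedComponent.eq]
  exact h.reachable

theorem ncard_edgeSet_deleteEdges_singleton (h : H.Adj x y) :
    (H.deleteEdges {s(x, y)}).edgeSet.ncard + 1 = H.edgeSet.ncard := by
  rw [edgeSet_deleteEdges]
  exact Set.ncard_sdiff_singleton_add_one h (Set.toFinite _)

theorem cyclomaticNumber_deleteEdges_of_isBridge (h : H.Adj x y) (hb : H.IsBridge s(x, y)) :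
    (H.deleteEdges {s(x, y)}).cyclomaticNumber = H.cyclomaticNumber := by
  have hedge := ncard_edgeSet_deleteEdges_singleton h
  have hcomp := card_connectedComponent_deleteEdges_of_isBridge h hb
  unfold cyclomaticNumber
  lia

theorem cyclomaticNumber_deleteEdges_of_not_isBridge (h : H.Adj x y)
    (hb : ¬ H.IsBridge s(x, y)) :
    (H.deleteEdges {s(x, y)}).cyclomaticNumber + 1 = H.cyclomaticNumber := by
  have hedge := ncard_edgeSet_deleteEdges_singleton h
  have hcomp := card_connectedComponent_deleteEdges_of_not_isBridge hb
  unfold cyclomaticNumber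
  lia

theorem cyclomaticNumber_deleteEdges_le (h : H.Adj x y) :
    (H.deleteEdges {s(x, y)}).cyclomaticNumber ≤ H.cyclomaticNumber := by
  by_cases hb : H.IsBridge s(x, y)
  · exact (cyclomaticNumber_deleteEdges_of_isBridge h hb).le
  · exact (Int.lt_of_add_one_le (cyclomaticNumber_deleteEdges_of_not_isBridge h hb).le).le

theorem cyclomaticNumber_mono (hle : G ≤ H) : G.cyclomaticNumber ≤ H.cyclomaticNumber := by
  induction H using WellFoundedLT.induction with
  | ind H ih =>
    rcases hle.eq_or_lt with rfl | hlt
    · exact le_rfl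
    · obtain ⟨x, y, h, h'⟩ := exists_adj_not_adj_of_lt hlt
      exact (ih _ (deleteEdges_singleton_lt h) (le_deleteEdges_singleton hle h')).trans
        (cyclomaticNumber_deleteEdges_le h)

theorem cyclomaticNumber_le_of_forall_isBridge (hle : G ≤ H)
    (hb : ∀ x y, H.Adj x y → ¬ G.Adj x y → H.IsBridge s(x, y)) :
    H.cyclomaticNumber ≤ G.cyclomaticNumber := by
  induction H using WellFoundedLT.induction with
  | ind H ih =>
    rcases hle.eq_or_lt with rfl | hlt
    · exact le_rfl
    · obtain ⟨x, y, h, h'⟩ := exists_adj_not_adj_of_lt hlt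
      rw [← cyclomaticNumber_deleteEdges_of_isBridge h (hb x y h h')]
      refine ih _ (deleteEdges_singleton_lt h) (le_deleteEdges_singleton hle h') fun u v hu hv => ?_
      exact (hb u v (deleteEdges_le _ hu) hv).anti (deleteEdges_le _)

theorem cyclomaticNumber_nonneg (H : SimpleGraph V) : 0 ≤ H.cyclomaticNumber :=
  cyclomaticNumber_bot (V := V) ▸ cyclomaticNumber_mono bot_le

theorem cyclomaticNumber_isolate_add_one_le {C : SimpleGraph V} (hC : IsCycleGraph C)
    (hle : C ≤ H) (hx : x ∈ C.support) :
    (isolate H {x}).cyclomaticNumber + 1 ≤ H.cyclomaticNumber := by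
  obtain ⟨u, hu⟩ := hx
  have hb := (not_isBridge_iff_exists_isCycleGraph (hle hu)).2 ⟨C, hle, hC, hu⟩
  rw [← cyclomaticNumber_deleteEdges_of_not_isBridge (hle hu) hb]
  gcongr
  exact cyclomaticNumber_mono (le_deleteEdges_singleton (isolate_le H _) fun h => h.2.1 rfl)

theorem cyclomaticNumber_isolate_add_two_le {C C' : SimpleGraph V} (hC : IsCycleGraph C)
    (hC' : IsCycleGraph C') (hle : C ≤ H) (hle' : C' ≤ H) {u : V} (hu : C.Adj x u)
    (hu' : ¬ C'.Adj x u) (hx : x ∈ C'.support) :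
    (isolate H {x}).cyclomaticNumber + 2 ≤ H.cyclomaticNumber := by
  have hb := (not_isBridge_iff_exists_isCycleGraph (hle hu)).2 ⟨C, hle, hC, hu⟩
  have hsub : isolate H {x} ≤ isolate (H.deleteEdges {s(x, u)}) {x} := le_isolate_iff.2
    ⟨le_deleteEdges_singleton (isolate_le H _) fun h => h.2.1 rfl,
      (le_isolate_iff.1 le_rfl).2⟩
  have hdelete := cyclomaticNumber_deleteEdges_of_not_isBridge (hle hu) hb
  have hisolate :=
    cyclomaticNumber_isolate_add_one_le hC' (le_deleteEdges_singleton hle' hu') hx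
  have hmono := cyclomaticNumber_mono hsub
  lia

end CyclomaticNumber

/-- The side of `x` of the edge `xy`: the component of `x` once the edge `xy` is deleted. -/
def edgeSide (H : SimpleGraph V) (x y : V) : Set V :=
  {v | (H.deleteEdges {s(x, y)}).Reachable x v}

theorem mem_edgeSide_self (H : SimpleGraph V) (x y : V) : x ∈ edgeSide H x y :=
  Reachable.refl _

theorem mem_edgeSide_of_adj {u v : V} (hu : u ∈ edgeSide H x y) (h : H.Adj u v)
    (hne : s(u, v) ≠ s(x, y)) : v ∈ edgeSide H x y :=
  Reachable.trans hu (Adj.reachable (deleteEdges_adj.2 ⟨h, hne⟩))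

theorem notMem_edgeSide_of_isBridge (hb : H.IsBridge s(x, y)) : y ∉ edgeSide H x y := hb

theorem notMem_edgeSide_swap_of_isBridge (hb : H.IsBridge s(x, y)) {z : V}
    (hz : z ∈ edgeSide H x y) : z ∉ edgeSide H y x := by
  intro hz'
  rw [edgeSide, Set.mem_ofPred_eq, Sym2.eq_swap] at hz'
  exact hb (Reachable.trans hz hz'.symm)

theorem edgeSide_ssubset {u v : V} (hu : u ∈ edgeSide H x y) (hne : s(u, v) ≠ s(x, y))
    (hadj : H.Adj u v) (hx : x ∉ edgeSide H v u) : edgeSide H v u ⊂ edgeSide H x y := by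
  refine ⟨fun z hz => ?_, fun h => hx (h (mem_edgeSide_self H x y))⟩
  refine (mem_of_reachable_of_forall_adj
    (S := {z | z ∈ edgeSide H v u ∧ z ∈ edgeSide H x y}) hz
    ⟨mem_edgeSide_self H v u, mem_edgeSide_of_adj hu hadj hne⟩ ?_).2
  rintro a ⟨ha, ha'⟩ b hab
  have hb : b ∈ edgeSide H v u := Reachable.trans ha hab.reachable
  refine ⟨hb, mem_edgeSide_of_adj ha' (deleteEdges_le _ hab) fun he => hx ?_⟩
  rcases Sym2.eq_iff.1 he with ⟨rfl, -⟩ | ⟨-, rfl⟩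
  exacts [ha, hb]

/-- An end bridge `xy` of `H`: a bridge with no bridge strictly on the side of `x`. In the tree of
bridges and bridgeless components, the side of `x` is a leaf. -/
structure IsEndBridge (H : SimpleGraph V) (x y : V) : Prop where
  adj : H.Adj x y
  isBridge : H.IsBridge s(x, y)
  not_isBridge : ∀ u v, H.Adj u v → u ∈ edgeSide H x y → v ∈ edgeSide H x y →
    ¬ H.IsBridge s(u, v)

theorem IsEndBridge.eq_of_isBridge {z : V} (h : IsEndBridge H x y) (hz : H.Adj x z)
    (hb : H.IsBridge s(x, z)) : z = y := by
  by_contra hne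
  have hx := mem_edgeSide_self H x y
  exact h.not_isBridge x z hz hx
    (mem_edgeSide_of_adj hx hz fun he => hne (Sym2.congr_right.1 he)) hb

theorem exists_edgeSide_ssubset {u v : V} (hb : H.IsBridge s(x, y)) (huv : H.Adj u v)
    (hbr : H.IsBridge s(u, v)) (hu : u ∈ edgeSide H x y) (hv : v ∈ edgeSide H x y) :
    ∃ x' y', (H.Adj x' y' ∧ H.IsBridge s(x', y')) ∧ edgeSide H x' y' ⊂ edgeSide H x y := by
  have hne : s(u, v) ≠ s(x, y) := fun he => by
    rcases Sym2.eq_iff.1 he with ⟨-, rfl⟩ | ⟨rfl, -⟩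
    exacts [notMem_edgeSide_of_isBridge hb hv, notMem_edgeSide_of_isBridge hb hu]
  by_cases hx : x ∈ edgeSide H v u
  · exact ⟨u, v, ⟨huv, hbr⟩, edgeSide_ssubset hv (by rwa [Sym2.eq_swap]) huv.symm
      (notMem_edgeSide_swap_of_isBridge (by rwa [Sym2.eq_swap]) hx)⟩
  · exact ⟨v, u, ⟨huv.symm, by rwa [Sym2.eq_swap]⟩, edgeSide_ssubset hu hne huv hx⟩

theorem exists_isEndBridge [Finite V] (hxy : H.Adj x y) (hb : H.IsBridge s(x, y)) :
    ∃ x' y', IsEndBridge H x' y' ∧ edgeSide H x' y' ⊆ edgeSide H x y := by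
  obtain ⟨S, hS, ⟨x', y', hxy', rfl⟩, hmin⟩ := exists_minimal_le_of_wellFoundedLT
    (fun S => ∃ x y, (H.Adj x y ∧ H.IsBridge s(x, y)) ∧ edgeSide H x y = S) _
    ⟨x, y, ⟨hxy, hb⟩, rfl⟩
  refine ⟨x', y', ⟨hxy'.1, hxy'.2, fun u v huv hu hv hbr => ?_⟩, hS⟩
  obtain ⟨a, b, hab, hlt⟩ := exists_edgeSide_ssubset hxy'.2 huv hbr hu hv
  exact hlt.not_subset (hmin ⟨a, b, hab, rfl⟩ hlt.subset)

end EdgeDeletion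

section CycleEnumeration

variable {V : Type*} {C : SimpleGraph V}

/-- An enumeration of a cycle `C` with `k` vertices: the edges of `C` are the consecutive pairs of
the sequence `p 0, …, p (k - 1), p k = p 0`. Values of `p` beyond index `k` are irrelevant. -/
structure IsCycleEnum (C : SimpleGraph V) (k : ℕ) (p : ℕ → V) : Prop where
  three_le : 3 ≤ k
  closed : p k = p 0
  injOn : Set.InjOn p (Set.Iio k)
  adj_iff : ∀ u v, C.Adj u v ↔ ∃ i < k, s(u, v) = s(p i, p (i + 1))

namespace IsCycleEnum

theorem of_isCycle {G : SimpleGraph V} {v : V} {w : G.Walk v v} (hw : w.IsCycle) :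
    IsCycleEnum w.toSubgraph.spanningCoe w.length w.getVert where
  three_le := hw.three_le_length
  closed := by rw [w.getVert_length, w.getVert_zero]
  injOn := fun _ hi _ hj hij =>
    hw.getVert_injOn' (Nat.le_sub_one_of_lt hi) (Nat.le_sub_one_of_lt hj) hij
  adj_iff := fun u v => by
    rw [Subgraph.spanningCoe_adj, Walk.toSubgraph_adj_iff]
    exact ⟨fun ⟨i, h, hi⟩ => ⟨i, hi, h.symm⟩, fun ⟨i, hi, h⟩ => ⟨i, h.symm, hi⟩⟩

variable {k : ℕ} {p : ℕ → V}

theorem adj (h : IsCycleEnum C k p) {i : ℕ} (hi : i < k) : C.Adj (p i) (p (i + 1)) :=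
  (h.adj_iff _ _).2 ⟨i, hi, rfl⟩

theorem mem_support_iff (h : IsCycleEnum C k p) {v : V} : v ∈ C.support ↔ ∃ i < k, p i = v := by
  constructor
  · rintro ⟨u, hu⟩
    obtain ⟨i, hi, he⟩ := (h.adj_iff _ _).1 hu
    rcases Sym2.eq_iff.1 he with ⟨rfl, -⟩ | ⟨rfl, -⟩
    · exact ⟨i, hi, rfl⟩
    · rcases Nat.lt_or_ge (i + 1) k with hlt | hge
      · exact ⟨i + 1, hlt, rfl⟩
      · exact ⟨0, by lia, by rw [show i + 1 = k by lia, h.closed]⟩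
  · rintro ⟨i, hi, rfl⟩
    exact ⟨_, h.adj hi⟩

theorem start_mem_support (h : IsCycleEnum C k p) : p 0 ∈ C.support :=
  h.mem_support_iff.2 ⟨0, by have := h.three_le; lia, rfl⟩

theorem ncard_support (h : IsCycleEnum C k p) : C.support.ncard = k := by
  have himage : C.support = p '' Set.Iio k := Set.ext fun _ => h.mem_support_iff
  rw [himage, h.injOn.ncard_image, Set.ncard_eq_toFinset_card', Set.toFinset_Iio, Nat.card_Iio]

theorem eq_or_eq_of_eq (h : IsCycleEnum C k p) {i j : ℕ} (hi : i ≤ k) (hj : j ≤ k)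
    (hij : p i = p j) : i = j ∨ (i = 0 ∧ j = k) ∨ (i = k ∧ j = 0) := by
  have hpos : 0 < k := by have := h.three_le; lia
  rcases hi.eq_or_lt with rfl | hi <;> rcases hj.eq_or_lt with rfl | hj
  · exact Or.inl rfl
  · exact Or.inr (Or.inr ⟨rfl, h.injOn hj hpos (hij.symm.trans h.closed)⟩)
  · exact Or.inr (Or.inl ⟨h.injOn hi hpos (hij.trans h.closed), rfl⟩)
  · exact Or.inl (h.injOn hi hj hij)

theorem edge_injOn (h : IsCycleEnum C k p) :
    Set.InjOn (fun i => s(p i, p (i + 1))) (Set.Iio k) := by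
  intro i (hi : i < k) j (hj : j < k) hij
  have := h.three_le
  rcases Sym2.eq_iff.1 hij with ⟨hstart, -⟩ | ⟨hcross, hcross'⟩
  · exact h.injOn hi hj hstart
  · have := h.eq_or_eq_of_eq hi.le hj hcross
    have := h.eq_or_eq_of_eq hi hj.le hcross'
    lia

theorem exists_isEdgeMatching_card (h : IsCycleEnum C k p) {a r : ℕ} (har : a + 2 * r ≤ k) :
    ∃ M, IsEdgeMatching C M ∧ M.card = r ∧
      ∀ e ∈ M, ∀ v ∈ e, ∃ i, a ≤ i ∧ i < a + 2 * r ∧ p i = v := by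
  classical
  let edge : ℕ → Sym2 V := fun i => s(p (a + 2 * i), p (a + 2 * i + 1))
  have hdisj : ∀ i < r, ∀ j < r, ∀ v, v ∈ edge i → v ∈ edge j → i = j := by
    intro i hi j hj v hvi hvj
    rcases Sym2.mem_iff.1 hvi with rfl | rfl <;> rcases Sym2.mem_iff.1 hvj with hij | hij <;>
      have := h.injOn (Set.mem_Iio.2 (by lia)) (Set.mem_Iio.2 (by lia)) hij <;> lia
  have hinj : Set.InjOn edge (Finset.range r) := by
    intro i hi j hj hij
    refine hdisj i (Finset.mem_range.1 hi) j (Finset.mem_range.1 hj) _ (Sym2.mem_mk_left _ _) ?_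
    exact hij ▸ Sym2.mem_mk_left _ _
  refine ⟨(Finset.range r).image edge, ⟨?_, ?_⟩, ?_, ?_⟩
  · simp only [Finset.forall_mem_image, Finset.mem_range]
    exact fun i hi => h.adj (by lia)
  · simp only [Finset.forall_mem_image, Finset.mem_range]
    exact fun i hi j hj v hvi hvj => congrArg edge (hdisj i hi j hj v hvi hvj)
  · rw [Finset.card_image_of_injOn hinj, Finset.card_range]
  · simp only [Finset.forall_mem_image, Finset.mem_range]
    intro i hi v hv
    rcases Sym2.mem_iff.1 hv with rfl | rfl
    exacts [⟨_, by lia, by lia, rfl⟩, ⟨_, by lia, by lia, rfl⟩]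

theorem le_matchingNumber_isolate [Finite V] (h : IsCycleEnum C k p) {S : Set V} {a r : ℕ}
    (hS : S ⊆ p '' Set.Iio a) (har : a + 2 * r ≤ k) : r ≤ (isolate C S).matchingNumber := by
  obtain ⟨M, hM, rfl, hv⟩ := h.exists_isEdgeMatching_card har
  have hiso : IsEdgeMatching (isolate C S) M := by
    refine ⟨fun e he => mem_edgeSet_isolate.2 ⟨hM.1 e he, fun v hve hvS => ?_⟩, hM.2⟩
    obtain ⟨i, hi, hik, rfl⟩ := hv e he v hve
    obtain ⟨j, hj, hji⟩ := hS hvS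
    rw [Set.mem_Iio] at hj
    have := h.injOn (Set.mem_Iio.2 (by lia)) (Set.mem_Iio.2 (by lia)) hji
    lia
  exact hiso.card_le

theorem two_mul_matchingNumber_le [Finite V] (h : IsCycleEnum C k p) :
    2 * C.matchingNumber ≤ k := by
  classical
  have := Fintype.ofFinite V
  obtain ⟨M, hM, hcard⟩ := exists_isEdgeMatching C
  rw [← hcard, ← h.ncard_support, Set.ncard_eq_toFinset_card']
  refine hM.two_mul_card_le fun e he v hv => ?_
  obtain ⟨u, rfl⟩ := Sym2.mem_iff_exists.1 hv
  exact Set.mem_toFinset.2 ⟨u, hM.1 _ he⟩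

end IsCycleEnum

theorem IsCycleGraph.exists_isCycleEnum (hC : IsCycleGraph C) {x : V} (hx : x ∈ C.support) :
    ∃ k p, IsCycleEnum C k p ∧ p 0 = x := by
  classical
  obtain ⟨y, w, hw, hwC⟩ := hC.exists_walk le_rfl
  have hxw : x ∈ w.support := by
    rwa [← hwC, mem_support_spanningCoe_iff_of_isCycle hw, Walk.mem_verts_toSubgraph] at hx
  have henum := IsCycleEnum.of_isCycle ((Walk.isCycle_rotate hxw).2 hw)
  rw [Walk.toSubgraph_rotate, hwC] at henum
  exact ⟨_, _, henum, Walk.getVert_zero _⟩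

end CycleEnumeration

section GainMatrix

variable {𝕜 V : Type*} [RCLike 𝕜] {a : V → V → 𝕜} {H C : SimpleGraph V}

/-- A gain function, extended by arbitrary unit values to all ordered pairs of vertices: the same
`a` then serves all subgraphs, and no edge has to be carried along as a proof. -/
structure IsUnitGain (a : V → V → 𝕜) : Prop where
  star_eq : ∀ u v, star (a u v) = a v u
  norm_eq : ∀ u v, ‖a u v‖ = 1

theorem IsUnitGain.mul_swap (ha : IsUnitGain a) (u v : V) : a u v * a v u = 1 := by
  rw [← ha.star_eq u v, RCLike.star_def, RCLike.mul_conj, ha.norm_eq]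
  simp

open Classical in
/-- The adjacency matrix of `H` weighted by `a`. -/
noncomputable def gainMatrix (a : V → V → 𝕜) (H : SimpleGraph V) : Matrix V V 𝕜 :=
  Matrix.of fun u v => if H.Adj u v then a u v else 0

theorem gainMatrix_apply_of_adj (a : V → V → 𝕜) {u v : V} (h : H.Adj u v) :
    gainMatrix a H u v = a u v := if_pos h

theorem gainMatrix_apply_of_not_adj (a : V → V → 𝕜) {u v : V} (h : ¬ H.Adj u v) :
    gainMatrix a H u v = 0 := if_neg h

theorem gainMatrix_isHermitian (ha : IsUnitGain a) (H : SimpleGraph V) :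
    (gainMatrix a H).IsHermitian := by
  ext u v
  rw [conjTranspose_apply]
  by_cases h : H.Adj u v
  · rw [gainMatrix_apply_of_adj a h, gainMatrix_apply_of_adj a h.symm, ha.star_eq]
  · rw [gainMatrix_apply_of_not_adj a h, gainMatrix_apply_of_not_adj a (mt Adj.symm h), star_zero]

theorem gainMatrix_sdiff_add (a : V → V → 𝕜) (hle : C ≤ H) :
    gainMatrix a (H \ C) + gainMatrix a C = gainMatrix a H := by
  ext u v
  have : C.Adj u v → H.Adj u v := @hle u v
  by_cases hC : C.Adj u v <;> by_cases hH : H.Adj u v <;> simp_all [gainMatrix]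

theorem exists_gainMatrix_isolate_eq [Fintype V] (a : V → V → 𝕜) (H : SimpleGraph V) (S : Set V) :
    ∃ P : Matrix V V 𝕜, (∀ f, ∀ v ∈ S, (P *ᵥ f) v = 0) ∧
      gainMatrix a (isolate H S) = Pᴴ * gainMatrix a H * P := by
  classical
  refine ⟨diagonal fun v => if v ∈ S then 0 else 1, fun f v hv => ?_, ?_⟩
  · rw [mulVec_diagonal, if_pos hv, zero_mul]
  · ext u v
    rw [diagonal_conjTranspose, mul_diagonal, diagonal_mul]
    by_cases hu : u ∈ S <;> by_cases hv : v ∈ S <;> simp [gainMatrix, hu, hv]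

variable [Fintype V]

theorem negIndex_gainMatrix_isolate_le (a : V → V → 𝕜) (H : SimpleGraph V) (S : Set V) :
    negIndex (gainMatrix a (isolate H S)) ≤ negIndex (gainMatrix a H) := by
  obtain ⟨P, -, hP⟩ := exists_gainMatrix_isolate_eq a H S
  rw [hP]
  exact negIndex_conjTranspose_mul_mul_le _ _

theorem negIndex_gainMatrix_le_sdiff_add (ha : IsUnitGain a) (hle : C ≤ H) :
    negIndex (gainMatrix a H) ≤
      negIndex (gainMatrix a (H \ C)) + negIndex (gainMatrix a C) := by
  classical
  rw [← gainMatrix_sdiff_add a hle]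
  exact negIndex_add_le (gainMatrix_isHermitian ha _) (gainMatrix_isHermitian ha _)

theorem reForm_gainMatrix (a : V → V → 𝕜) (H : SimpleGraph V) (f : V → 𝕜) :
    reForm (gainMatrix a H) f = RCLike.re (∑ u, ∑ v, star (f u) * gainMatrix a H u v * f v) := by
  simp only [reForm, dotProduct, mulVec, Pi.star_apply, Finset.mul_sum, mul_assoc]

theorem negIndex_gainMatrix_le_card_of_isVertexCover (a : V → V → 𝕜) {K : Finset V}
    (hK : H.IsVertexCover K) : negIndex (gainMatrix a H) ≤ K.card := by
  have hle := negIndex_le_finrank_of_ker (A := gainMatrix a H)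
    (LinearMap.funLeft 𝕜 𝕜 ((↑) : K → V)) fun f hf => ?_
  · simpa using hle
  have hzero : ∀ v ∈ K, f v = 0 := fun v hv => congrFun hf ⟨v, hv⟩
  rw [reForm_gainMatrix, Finset.sum_eq_zero fun u _ => Finset.sum_eq_zero fun v _ => ?_, map_zero]
  by_cases h : H.Adj u v
  · rcases hK h with hu | hv
    · rw [hzero u hu, star_zero, zero_mul, zero_mul]
    · rw [hzero v hv, mul_zero]
  · rw [gainMatrix_apply_of_not_adj a h, mul_zero, zero_mul]

end GainMatrix

section Pendant

variable {𝕜 V : Type*} [RCLike 𝕜] [Fintype V]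

theorem reForm_add_vec {A : Matrix V V 𝕜} (hA : A.IsHermitian) (f g : V → 𝕜) :
    reForm A (f + g) = reForm A f + reForm A g + 2 * RCLike.re (star g ⬝ᵥ A *ᵥ f) := by
  have hswap : star f ⬝ᵥ A *ᵥ g = star (star g ⬝ᵥ A *ᵥ f) := by
    rw [star_dotProduct, star_mulVec, hA.eq, ← dotProduct_mulVec]
  simp only [reForm, star_add, add_dotProduct, mulVec_add, dotProduct_add, map_add, hswap,
    RCLike.star_def, RCLike.conj_re]
  ring

theorem reForm_smul (A : Matrix V V 𝕜) (c : 𝕜) (f : V → 𝕜) :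
    reForm A (c • f) = ‖c‖ ^ 2 * reForm A f := by
  rw [reForm, reForm, star_smul, mulVec_smul, smul_dotProduct, dotProduct_smul, smul_eq_mul,
    smul_eq_mul, ← mul_assoc, RCLike.star_def, RCLike.conj_mul, ← RCLike.ofReal_pow,
    RCLike.re_ofReal_mul]

theorem finrank_add_one_le_negIndex_of_orthogonal {E : Type*} [AddCommGroup E] [Module 𝕜 E]
    [FiniteDimensional 𝕜 E] {A : Matrix V V 𝕜} (hA : A.IsHermitian) (L : E →ₗ[𝕜] (V → 𝕜))
    {z : V → 𝕜} (hL : ∀ g, g ≠ 0 → reForm A (L g) < 0) (hz : reForm A z < 0)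
    (horth : ∀ g, star z ⬝ᵥ A *ᵥ L g = 0) : Module.finrank 𝕜 E + 1 ≤ negIndex A := by
  have hsum : Module.finrank 𝕜 (E × 𝕜) = Module.finrank 𝕜 E + 1 := by
    rw [Module.finrank_prod, Module.finrank_self]
  rw [← hsum]
  refine finrank_le_negIndex_of_linearMap (L.coprod (LinearMap.toSpanSingleton 𝕜 _ z)) ?_
  rintro ⟨g, c⟩ hgc
  have hform : reForm A (L g + c • z) = reForm A (L g) + ‖c‖ ^ 2 * reForm A z := by
    rw [reForm_add_vec hA, reForm_smul, star_smul, smul_dotProduct, horth, smul_zero, map_zero,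
      mul_zero, add_zero]
  rw [LinearMap.coprod_apply, LinearMap.toSpanSingleton_apply, hform]
  by_cases hg : g = 0
  · have hc : 0 < ‖c‖ := norm_pos_iff.2 fun hc => hgc (Prod.ext hg hc)
    rw [hg, map_zero, reForm_zero, zero_add]
    exact mul_neg_of_pos_of_neg (by positivity) hz
  · exact add_neg_of_neg_of_nonpos (hL g hg)
      (mul_nonpos_of_nonneg_of_nonpos (by positivity) hz.le)

variable {a : V → V → 𝕜} {H : SimpleGraph V} {x y : V}

theorem gainMatrix_mulVec_of_pendant (a : V → V → 𝕜) (hxy : H.Adj x y)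
    (hx : ∀ v, H.Adj x v → v = y) (f : V → 𝕜) : (gainMatrix a H *ᵥ f) x = a x y * f y := by
  rw [mulVec, dotProduct, Finset.sum_eq_single_of_mem y (Finset.mem_univ y),
    gainMatrix_apply_of_adj a hxy]
  exact fun v _ hv => by rw [gainMatrix_apply_of_not_adj a (mt (hx v) hv), zero_mul]

section PendantVector

variable [DecidableEq V]

theorem star_single_dotProduct (u : V) (c : 𝕜) (f : V → 𝕜) :
    star (Pi.single u c) ⬝ᵥ f = star c * f u := by
  rw [← Pi.single_star, single_dotProduct]

theorem gainMatrix_mulVec_single_apply (a : V → V → 𝕜) (H : SimpleGraph V) (u v : V) (c : 𝕜) :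
    (gainMatrix a H *ᵥ Pi.single u c) v = gainMatrix a H v u * c := by
  rw [mulVec_single, Pi.smul_apply, col_apply, MulOpposite.smul_eq_mul_unop, MulOpposite.unop_op]

theorem reForm_gainMatrix_add_single_of_pendant (ha : IsUnitGain a) (hxy : H.Adj x y)
    (hx : ∀ v, H.Adj x v → v = y) {f : V → 𝕜} (hf : f y = 0) (c : 𝕜) :
    reForm (gainMatrix a H) (f + Pi.single x c) = reForm (gainMatrix a H) f := by
  have hsingle : reForm (gainMatrix a H) (Pi.single x c) = 0 := by
    rw [reForm, star_single_dotProduct, gainMatrix_mulVec_of_pendant a hxy hx,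
      Pi.single_eq_of_ne hxy.ne', mul_zero, mul_zero, map_zero]
  rw [reForm_add_vec (gainMatrix_isHermitian ha H), hsingle, star_single_dotProduct,
    gainMatrix_mulVec_of_pendant a hxy hx, hf, mul_zero, mul_zero, map_zero, mul_zero, add_zero,
    add_zero]

/-- A negative vector of the hyperbolic plane spanned by a pendant vertex `x` and its neighbour
`y`. -/
def pendantVector (a : V → V → 𝕜) (x y : V) : V → 𝕜 := Pi.single y 1 - Pi.single x (a x y)

theorem star_pendantVector_dotProduct (ha : IsUnitGain a) (x y : V) (f : V → 𝕜) :
    star (pendantVector a x y) ⬝ᵥ f = f y - a y x * f x := by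
  rw [pendantVector, star_sub, sub_dotProduct, star_single_dotProduct, star_single_dotProduct,
    star_one, one_mul, ha.star_eq]

theorem reForm_gainMatrix_pendantVector (ha : IsUnitGain a) (hxy : H.Adj x y)
    (hx : ∀ v, H.Adj x v → v = y) :
    reForm (gainMatrix a H) (pendantVector a x y) = -2 := by
  have hval_y : pendantVector a x y y = 1 := by
    simp [pendantVector, hxy.ne']
  have hmul_y : (gainMatrix a H *ᵥ pendantVector a x y) y = -1 := by
    rw [pendantVector, mulVec_sub, Pi.sub_apply, gainMatrix_mulVec_single_apply,
      gainMatrix_mulVec_single_apply, gainMatrix_apply_of_not_adj a H.irrefl,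
      gainMatrix_apply_of_adj a hxy.symm, ha.mul_swap, zero_mul, zero_sub]
  rw [reForm, star_pendantVector_dotProduct ha, hmul_y, gainMatrix_mulVec_of_pendant a hxy hx,
    hval_y, mul_one, ha.mul_swap]
  simp
  norm_num

end PendantVector

theorem negIndex_gainMatrix_isolate_pendant_add_one_le (ha : IsUnitGain a) (hxy : H.Adj x y)
    (hx : ∀ v, H.Adj x v → v = y) :
    negIndex (gainMatrix a (isolate H {x, y})) + 1 ≤ negIndex (gainMatrix a H) := by
  classical
  obtain ⟨U, hU, hneg⟩ := exists_finrank_eq_negIndex (gainMatrix a (isolate H {x, y}))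
  obtain ⟨P, hPzero, hP⟩ := exists_gainMatrix_isolate_eq a H {x, y}
  have hPy : ∀ f, (P *ᵥ f) y = 0 := fun f => hPzero f y (Set.mem_insert_of_mem x rfl)
  -- The coefficient at `x` makes the image of `L` orthogonal to `pendantVector a x y`.
  let coeff : (V → 𝕜) →ₗ[𝕜] 𝕜 :=
    -(a x y) • (LinearMap.proj y ∘ₗ (gainMatrix a H).mulVecLin ∘ₗ P.mulVecLin)
  let L : (V → 𝕜) →ₗ[𝕜] (V → 𝕜) := P.mulVecLin + LinearMap.single 𝕜 _ x ∘ₗ coeff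
  have hL : ∀ f, L f = P *ᵥ f + Pi.single x (-(a x y) * (gainMatrix a H *ᵥ P *ᵥ f) y) :=
    fun f => rfl
  have hLy : ∀ f, L f y = 0 := fun f => by
    rw [hL, Pi.add_apply, hPy, Pi.single_eq_of_ne hxy.ne', add_zero]
  rw [← hU]
  refine finrank_add_one_le_negIndex_of_orthogonal (gainMatrix_isHermitian ha H)
    (L ∘ₗ U.subtype) (z := pendantVector a x y) (fun g hg => ?_) ?_ fun g => ?_
  · rw [LinearMap.comp_apply, hL, reForm_gainMatrix_add_single_of_pendant ha hxy hx (hPy _),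
      ← reForm_conjTranspose_mul_mul, ← hP]
    exact hneg g g.2 (by simpa using hg)
  · rw [reForm_gainMatrix_pendantVector ha hxy hx]
    norm_num
  · rw [star_pendantVector_dotProduct ha, gainMatrix_mulVec_of_pendant a hxy hx,
      LinearMap.comp_apply, hLy, hL, mulVec_add, Pi.add_apply, gainMatrix_mulVec_single_apply,
      gainMatrix_apply_of_adj a hxy.symm]
    linear_combination -(gainMatrix a H *ᵥ P *ᵥ U.subtype g) y * ha.mul_swap y x

end Pendant

section CycleForm

variable {𝕜 V : Type*} [RCLike 𝕜] {a : V → V → 𝕜} {C : SimpleGraph V} {k r : ℕ} {p : ℕ → V}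

theorem sum_range_two_mul {M : Type*} [AddCommMonoid M] (r : ℕ) (g : ℕ → M) :
    ∑ i ∈ Finset.range (2 * r), g i = ∑ j ∈ Finset.range r, (g (2 * j) + g (2 * j + 1)) := by
  induction r with
  | zero => rfl
  | succ r ih =>
    rw [mul_add_one, Finset.sum_range_succ, Finset.sum_range_succ, ih, Finset.sum_range_succ,
      add_assoc]

theorem IsCycleEnum.gainMatrix_eq_sum [DecidableEq V] (h : IsCycleEnum C k p) (a : V → V → 𝕜) :
    gainMatrix a C = ∑ i ∈ Finset.range k,
      (single (p i) (p (i + 1)) (a (p i) (p (i + 1))) +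
        single (p (i + 1)) (p i) (a (p (i + 1)) (p i))) := by
  have hsingle : ∀ i < k, ∀ u v,
      (single (p i) (p (i + 1)) (a (p i) (p (i + 1))) +
        single (p (i + 1)) (p i) (a (p (i + 1)) (p i))) u v =
      if s(u, v) = s(p i, p (i + 1)) then a u v else 0 := by
    intro i hi u v
    have := (h.adj hi).ne
    simp only [Matrix.add_apply, single_apply, Sym2.eq_iff]
    grind
  ext u v
  rw [Matrix.sum_apply, Finset.sum_congr rfl fun i hi => hsingle i (Finset.mem_range.1 hi) u v]
  by_cases huv : C.Adj u v
  · obtain ⟨i, hi, he⟩ := (h.adj_iff u v).1 huv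
    rw [gainMatrix_apply_of_adj a huv, Finset.sum_eq_single_of_mem i (Finset.mem_range.2 hi)
      fun j hj hji => if_neg fun hj' => hji (h.edge_injOn (Finset.mem_range.1 hj) hi
        (hj'.symm.trans he)), if_pos he]
  · rw [gainMatrix_apply_of_not_adj a huv, Finset.sum_eq_zero fun i hi => if_neg fun he =>
      huv ((h.adj_iff u v).2 ⟨i, Finset.mem_range.1 hi, he⟩)]

/-- The coordinate at `p (2 j + 1)` of the gain matrix of the cycle enumerated by `p`, applied to a
vector, as a linear form. -/
def oddRow (a : V → V → 𝕜) (p : ℕ → V) (j : ℕ) : (V → 𝕜) →ₗ[𝕜] 𝕜 :=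
  a (p (2 * j + 1)) (p (2 * j)) • LinearMap.proj (p (2 * j)) +
    a (p (2 * j + 1)) (p (2 * j + 2)) • LinearMap.proj (p (2 * j + 2))

theorem oddRow_apply (a : V → V → 𝕜) (p : ℕ → V) (j : ℕ) (f : V → 𝕜) :
    oddRow a p j f = a (p (2 * j + 1)) (p (2 * j)) * f (p (2 * j)) +
      a (p (2 * j + 1)) (p (2 * j + 2)) * f (p (2 * j + 2)) := rfl

theorem IsUnitGain.norm_prod (ha : IsUnitGain a) (p : ℕ → V) (k : ℕ) :
    ‖∏ i ∈ Finset.range k, a (p i) (p (i + 1))‖ = 1 := by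
  rw [_root_.norm_prod, Finset.prod_eq_one fun i _ => ha.norm_eq _ _]

theorem prod_gain_mul_eq_of_oddRow_eq_zero (ha : IsUnitGain a) {f : V → 𝕜} {m : ℕ}
    (h : ∀ j < m, oddRow a p j f = 0) :
    (∏ i ∈ Finset.range (2 * m), a (p i) (p (i + 1))) * f (p (2 * m)) = (-1) ^ m * f (p 0) := by
  induction m with
  | zero => simp
  | succ m ih =>
    have hprev := ih fun j hj => h j (hj.trans m.lt_succ_self)
    have hrow := h m m.lt_succ_self
    have hswap := ha.mul_swap (p (2 * m)) (p (2 * m + 1))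
    rw [oddRow_apply] at hrow
    rw [mul_add_one, Finset.prod_range_succ, Finset.prod_range_succ, pow_succ]
    linear_combination -hprev + (∏ i ∈ Finset.range (2 * m), a (p i) (p (i + 1))) *
      (a (p (2 * m)) (p (2 * m + 1)) * hrow - f (p (2 * m)) * hswap)

theorem IsCycleEnum.oddRow_last_eq_zero (h : IsCycleEnum C (2 * (r + 1)) p) (ha : IsUnitGain a)
    (hgain : ∏ i ∈ Finset.range (2 * (r + 1)), a (p i) (p (i + 1)) = (-1) ^ (r + 1))
    {f : V → 𝕜} (hf : ∀ j < r, oddRow a p j f = 0) : oddRow a p r f = 0 := by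
  have hprev := prod_gain_mul_eq_of_oddRow_eq_zero ha hf
  have hswap := ha.mul_swap (p (2 * r)) (p (2 * r + 1))
  have hne : ∏ i ∈ Finset.range (2 * r + 1), a (p i) (p (i + 1)) ≠ 0 :=
    norm_ne_zero_iff.1 (by rw [ha.norm_prod]; exact one_ne_zero)
  refine (mul_eq_zero.1 ?_).resolve_left hne
  have hclosed : p (2 * r + 2) = p 0 := h.closed
  rw [mul_add_one, Finset.prod_range_succ, Finset.prod_range_succ, hclosed, pow_succ] at hgain
  rw [oddRow_apply, hclosed, Finset.prod_range_succ]
  linear_combination hprev + f (p 0) * hgain +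
    (∏ i ∈ Finset.range (2 * r), a (p i) (p (i + 1))) * f (p (2 * r)) * hswap

theorem IsCycleEnum.eq_zero_of_oddRow_eq_zero (h : IsCycleEnum C (2 * r) p) (ha : IsUnitGain a)
    (hgain : ∏ i ∈ Finset.range (2 * r), a (p i) (p (i + 1)) ≠ (-1) ^ r) {f : V → 𝕜}
    (hf : ∀ j < r, oddRow a p j f = 0) : ∀ j ≤ r, f (p (2 * j)) = 0 := by
  have hstart : f (p 0) = 0 := by
    have hall := prod_gain_mul_eq_of_oddRow_eq_zero ha hf
    rw [h.closed] at hall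
    exact by_contra fun hne => hgain (mul_right_cancel₀ hne hall)
  intro j hj
  have hprefix := prod_gain_mul_eq_of_oddRow_eq_zero ha fun i hi => hf i (hi.trans_le hj)
  rw [hstart, mul_zero] at hprefix
  refine (mul_eq_zero.1 hprefix).resolve_left (norm_ne_zero_iff.1 ?_)
  rw [ha.norm_prod]
  exact one_ne_zero

variable [Fintype V]

theorem reForm_sum {ι : Type*} (s : Finset ι) (A : ι → Matrix V V 𝕜) (f : V → 𝕜) :
    reForm (∑ i ∈ s, A i) f = ∑ i ∈ s, reForm (A i) f := by
  simp only [reForm, sum_mulVec, dotProduct_sum, map_sum]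

theorem reForm_single [DecidableEq V] (u v : V) (c : 𝕜) (f : V → 𝕜) :
    reForm (single u v c) f = RCLike.re (star (f u) * (c * f v)) := by
  simp [reForm, single_mulVec, dotProduct, Function.update_apply]

namespace IsCycleEnum

theorem reForm_gainMatrix (h : IsCycleEnum C k p) (ha : IsUnitGain a) (f : V → 𝕜) :
    reForm (gainMatrix a C) f = ∑ i ∈ Finset.range k,
      2 * RCLike.re (star (f (p (i + 1))) * (a (p (i + 1)) (p i) * f (p i))) := by
  classical
  rw [h.gainMatrix_eq_sum, reForm_sum]
  refine Finset.sum_congr rfl fun i _ => ?_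
  have hswap : star (f (p i)) * (a (p i) (p (i + 1)) * f (p (i + 1))) =
      star (star (f (p (i + 1))) * (a (p (i + 1)) (p i) * f (p i))) := by
    simp only [star_mul', star_star, ha.star_eq]
    ring
  rw [reForm_add, reForm_single, reForm_single, hswap, RCLike.star_def, RCLike.conj_re, two_mul]

theorem reForm_gainMatrix_eq_sum_oddRow (h : IsCycleEnum C (2 * r) p) (ha : IsUnitGain a)
    (f : V → 𝕜) :
    reForm (gainMatrix a C) f =
      ∑ j ∈ Finset.range r, 2 * RCLike.re (star (f (p (2 * j + 1))) * oddRow a p j f) := by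
  rw [h.reForm_gainMatrix ha, sum_range_two_mul]
  refine Finset.sum_congr rfl fun j _ => ?_
  have hswap : star (f (p (2 * j + 2))) * (a (p (2 * j + 2)) (p (2 * j + 1)) * f (p (2 * j + 1))) =
      star (star (f (p (2 * j + 1))) *
        (a (p (2 * j + 1)) (p (2 * j + 2)) * f (p (2 * j + 2)))) := by
    simp only [star_mul', star_star, ha.star_eq]
    ring
  rw [hswap, RCLike.star_def, RCLike.conj_re, ← mul_add, ← map_add, oddRow_apply, mul_add]

theorem negIndex_add_one_le (h : IsCycleEnum C (2 * r) p) (ha : IsUnitGain a)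
    (hgain : ∏ i ∈ Finset.range (2 * r), a (p i) (p (i + 1)) = (-1) ^ r) :
    negIndex (gainMatrix a C) + 1 ≤ r := by
  obtain ⟨m, rfl⟩ : ∃ m, r = m + 1 := Nat.exists_eq_add_one.2 (by have := h.three_le; lia)
  have hle := negIndex_le_finrank_of_ker (A := gainMatrix a C)
    (LinearMap.pi fun j : Fin m => oddRow a p j) fun f hf => ?_
  · simpa using hle
  have hrow : ∀ j < m, oddRow a p j f = 0 := fun j hj => congrFun hf ⟨j, hj⟩
  rw [h.reForm_gainMatrix_eq_sum_oddRow ha, Finset.sum_eq_zero fun j hj => ?_]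
  have hj0 : oddRow a p j f = 0 := by
    rcases (Finset.mem_range_succ_iff.1 hj).lt_or_eq with hj | rfl
    exacts [hrow j hj, h.oddRow_last_eq_zero ha hgain hrow]
  rw [hj0, mul_zero, map_zero, mul_zero]

theorem reForm_gainMatrix_neg (h : IsCycleEnum C (2 * r) p) (ha : IsUnitGain a)
    (hgain : ∏ i ∈ Finset.range (2 * r), a (p i) (p (i + 1)) ≠ (-1) ^ r) {f : V → 𝕜}
    (hodd : ∀ j < r, f (p (2 * j + 1)) = -oddRow a p j f) (hoff : ∀ v ∉ C.support, f v = 0)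
    (hf : f ≠ 0) : reForm (gainMatrix a C) f < 0 := by
  have hform : reForm (gainMatrix a C) f = -∑ j ∈ Finset.range r, 2 * ‖oddRow a p j f‖ ^ 2 := by
    rw [h.reForm_gainMatrix_eq_sum_oddRow ha, ← Finset.sum_neg_distrib]
    refine Finset.sum_congr rfl fun j hj => ?_
    rw [hodd j (Finset.mem_range.1 hj), star_neg, neg_mul, RCLike.star_def, RCLike.conj_mul,
      map_neg, ← RCLike.ofReal_pow, RCLike.ofReal_re, mul_neg]
  obtain ⟨j, hj, hj0⟩ : ∃ j < r, oddRow a p j f ≠ 0 := by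
    by_contra! hrow
    have heven := h.eq_zero_of_oddRow_eq_zero ha hgain hrow
    refine hf (funext fun v => by_contra fun hv => ?_)
    obtain ⟨i, hi, rfl⟩ := h.mem_support_iff.1 (not_imp_comm.1 (hoff v) hv)
    rcases Nat.even_or_odd' i with ⟨j, rfl | rfl⟩
    · exact hv (heven j (by lia))
    · exact hv (by rw [hodd j (by lia), hrow j (by lia), neg_zero, Pi.zero_apply])
  rw [hform, neg_lt_zero]
  exact Finset.sum_pos' (fun _ _ => by positivity) ⟨j, Finset.mem_range.2 hj, by positivity⟩

theorem le_negIndex (h : IsCycleEnum C (2 * r) p) (ha : IsUnitGain a)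
    (hgain : ∏ i ∈ Finset.range (2 * r), a (p i) (p (i + 1)) ≠ (-1) ^ r) :
    r ≤ negIndex (gainMatrix a C) := by
  classical
  have hcard : Fintype.card V ≤ negIndex (gainMatrix a C) + (r + (C.support)ᶜ.ncard) := by
    have hle := card_le_negIndex_add_finrank_of_ker (A := gainMatrix a C)
      ((LinearMap.pi fun j : Fin r => LinearMap.proj (p (2 * j + 1)) + oddRow a p j).prod
        (LinearMap.funLeft 𝕜 𝕜 ((↑) : ↥(C.support)ᶜ → V))) fun f hf hf0 =>
      h.reForm_gainMatrix_neg ha hgain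
        (fun j hj => eq_neg_of_add_eq_zero_left (congrFun (congrArg Prod.fst hf) ⟨j, hj⟩))
        (fun v hv => congrFun (congrArg Prod.snd hf) ⟨v, hv⟩) hf0
    rwa [Module.finrank_prod, Module.finrank_fin_fun, Module.finrank_fintype_fun_eq_card,
      ← Nat.card_eq_fintype_card (α := ↥(C.support)ᶜ), Nat.card_coe_set_eq] at hle
  have hncard := Set.ncard_add_ncard_compl C.support
  rw [h.ncard_support, Nat.card_eq_fintype_card] at hncard
  lia

end IsCycleEnum

end CycleForm

section Tight

variable {𝕜 V : Type*} [RCLike 𝕜] {a : V → V → 𝕜} {H C : SimpleGraph V} {x y : V}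

theorem forall_isBridge_of_forall_cycle_eq (h : ∀ C' ≤ H, IsCycleGraph C' → C' = C) :
    ∀ u v, H.Adj u v → ¬ C.Adj u v → H.IsBridge s(u, v) := by
  intro u v huv hnot
  by_contra hb
  obtain ⟨C', hle, hC', hadj⟩ := (not_isBridge_iff_exists_isCycleGraph huv).1 hb
  exact hnot (h C' hle hC' ▸ hadj)

theorem exists_pendant_of_forall_isBridge [Finite V] (hC : IsCycleGraph C)
    (hlt : C < H) (hb : ∀ u v, H.Adj u v → ¬ C.Adj u v → H.IsBridge s(u, v)) :
    ∃ x y, H.Adj x y ∧ ∀ z, H.Adj x z → z = y := by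
  obtain ⟨s, hs⟩ : C.support.Nonempty := by
    obtain ⟨s, t, hst⟩ := hC.exists_adj
    exact ⟨s, t, hst⟩
  have haway : ∀ x y, H.Adj x y → ¬ C.Adj x y → s ∉ edgeSide H x y →
      ∃ x y, H.Adj x y ∧ ∀ z, H.Adj x z → z = y := by
    intro x y hxy hnot hside
    obtain ⟨x', y', hend, hsub⟩ := exists_isEndBridge hxy (hb x y hxy hnot)
    have hx' : x' ∉ C.support := fun hx' => hside <|
      Reachable.trans (hsub (mem_edgeSide_self H x' y'))
        ((hC.reachable hx' hs).mono (le_deleteEdges_singleton hlt.le hnot))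
    exact ⟨x', y', hend.adj,
      fun z hz => hend.eq_of_isBridge hz (hb x' z hz fun hadj => hx' ⟨z, hadj⟩)⟩
  obtain ⟨x, y, hxy, hnot⟩ := exists_adj_not_adj_of_lt hlt
  by_cases hside : s ∈ edgeSide H x y
  · exact haway y x hxy.symm (fun h => hnot h.symm)
      (notMem_edgeSide_swap_of_isBridge (hb x y hxy hnot) hside)
  · exact haway x y hxy hnot hside

variable [Fintype V]

theorem matchingNumber_le_negIndex_add_cyclomaticNumber (ha : IsUnitGain a) (H : SimpleGraph V) :
    (H.matchingNumber : ℤ) ≤ negIndex (gainMatrix a H) + H.cyclomaticNumber := by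
  induction H using WellFoundedLT.induction with
  | ind H ih =>
    by_cases hH : H.IsAcyclic
    swap
    · obtain ⟨C, hle, hC⟩ := exists_isCycleGraph_of_not_isAcyclic hH
      obtain ⟨x, u, hxu⟩ := hC.exists_adj
      have hih := ih _ (isolate_lt (hle hxu) (Set.mem_singleton x))
      have hm := matchingNumber_le_isolate_singleton H x
      have hn := negIndex_gainMatrix_isolate_le a H {x}
      have hc := cyclomaticNumber_isolate_add_one_le hC hle ⟨u, hxu⟩
      lia
    rw [isAcyclic_iff_forall_adj_isBridge] at hH
    obtain rfl | hne := eq_or_ne H ⊥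
    · rw [matchingNumber_bot, cyclomaticNumber_bot]
      positivity
    obtain ⟨u, v, huv, -⟩ := exists_adj_not_adj_of_lt (bot_lt_iff_ne_bot.2 hne)
    obtain ⟨x, y, hend, -⟩ := exists_isEndBridge huv (hH huv)
    have hx : ∀ z, H.Adj x z → z = y := fun z hz => hend.eq_of_isBridge hz (hH hz)
    have hih := ih _ (isolate_lt (S := {x, y}) hend.adj (Set.mem_insert x _))
    have hm := matchingNumber_le_isolate_pendant hx
    have hn := negIndex_gainMatrix_isolate_pendant_add_one_le ha hend.adj hx
    have hc := cyclomaticNumber_mono (isolate_le H {x, y})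
    lia

/-- The negative index attains its lower bound `m(H) - c(H)`. The inequality is the one that is not
automatic, see `matchingNumber_le_negIndex_add_cyclomaticNumber`. -/
def IsTight (a : V → V → 𝕜) (H : SimpleGraph V) : Prop :=
  (negIndex (gainMatrix a H) : ℤ) + H.cyclomaticNumber ≤ H.matchingNumber

namespace IsTight

theorem isolate_singleton (ha : IsUnitGain a) (h : IsTight a H) (hle : C ≤ H)
    (hC : IsCycleGraph C) (hx : x ∈ C.support) :
    IsTight a (isolate H {x}) ∧ (isolate H {x}).matchingNumber + 1 = H.matchingNumber ∧
      (isolate H {x}).cyclomaticNumber + 1 = H.cyclomaticNumber := by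
  have hbound := matchingNumber_le_negIndex_add_cyclomaticNumber ha (isolate H {x})
  have hm := matchingNumber_le_isolate_singleton H x
  have hn := negIndex_gainMatrix_isolate_le a H {x}
  have hc := cyclomaticNumber_isolate_add_one_le hC hle hx
  unfold IsTight at h ⊢
  lia

theorem isolate_pendant (ha : IsUnitGain a) (h : IsTight a H) (hxy : H.Adj x y)
    (hx : ∀ z, H.Adj x z → z = y) :
    IsTight a (isolate H {x, y}) ∧ ∀ C ≤ H, IsCycleGraph C → Disjoint C.support {x, y} := by
  have hbound := matchingNumber_le_negIndex_add_cyclomaticNumber ha (isolate H {x, y})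
  have hm := matchingNumber_le_isolate_pendant hx
  have hn := negIndex_gainMatrix_isolate_pendant_add_one_le ha hxy hx
  have hc := cyclomaticNumber_mono (isolate_le H {x, y})
  unfold IsTight at h ⊢
  refine ⟨by lia, fun C hle hC => ?_⟩
  have hy : y ∉ C.support := fun hy => by
    have hcy := cyclomaticNumber_isolate_add_one_le hC hle hy
    have hmono : isolate H {x, y} ≤ isolate H {y} := fun u v huv =>
      ⟨huv.1, fun hu => huv.2.1 (Or.inr hu), fun hv => huv.2.2 (Or.inr hv)⟩
    have := cyclomaticNumber_mono hmono
    lia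
  rw [Set.disjoint_right]
  rintro v (rfl | rfl)
  · rintro ⟨z, hz⟩
    obtain rfl := hx z (hle hz)
    exact hy ⟨_, hz.symm⟩
  · exact hy

theorem disjointCycles (ha : IsUnitGain a) (h : IsTight a H) : DisjointCycles H := by
  have hle : ∀ C ≤ H, ∀ C' ≤ H, IsCycleGraph C → IsCycleGraph C' →
      ∀ v ∈ C.support, v ∈ C'.support → C ≤ C' := by
    intro C hC C' hC' hcyc hcyc' v hv hv'
    refine hcyc.le_of_forall_adj hv hv' fun w _ hw' u huw => by_contra fun hnot => ?_
    have hone := (h.isolate_singleton ha hC' hcyc' hw').2.2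
    have htwo := cyclomaticNumber_isolate_add_two_le hcyc hcyc' hC hC' huw hnot hw'
    lia
  exact fun C hC C' hC' hcyc hcyc' v hv hv' =>
    (hle C hC C' hC' hcyc hcyc' v hv hv').antisymm (hle C' hC' C hC hcyc' hcyc v hv' hv)

theorem of_isCycleGraph_le (ha : IsUnitGain a) (h : IsTight a H) (hC : IsCycleGraph C)
    (hle : C ≤ H) : IsTight a C := by
  induction H using WellFoundedLT.induction with
  | ind H ih =>
    by_cases hother : ∃ C' ≤ H, IsCycleGraph C' ∧ C' ≠ C
    · obtain ⟨C', hle', hC', hne⟩ := hother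
      obtain ⟨x, u, hxu⟩ := hC'.exists_adj
      have hx : x ∉ C.support := fun hx =>
        hne (h.disjointCycles ha C' hle' C hle hC' hC x ⟨u, hxu⟩ hx)
      exact ih _ (isolate_lt (hle' hxu) (Set.mem_singleton x))
        (h.isolate_singleton ha hle' hC' ⟨u, hxu⟩).1
        (le_isolate_iff.2 ⟨hle, Set.disjoint_singleton_right.2 hx⟩)
    push Not at hother
    obtain rfl | hlt := hle.eq_or_lt
    · exact h
    obtain ⟨x, y, hxy, hx⟩ := exists_pendant_of_forall_isBridge hC hlt
      (forall_isBridge_of_forall_cycle_eq hother)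
    obtain ⟨htight, hdisj⟩ := h.isolate_pendant ha hxy hx
    exact ih _ (isolate_lt hxy (Set.mem_insert x _)) htight (le_isolate_iff.2 ⟨hle, hdisj C hle hC⟩)

end IsTight

theorem IsTight.gain_eq_of_isCycleEnum (ha : IsUnitGain a) (h : IsTight a C) {k : ℕ} {p : ℕ → V}
    (hp : IsCycleEnum C k p) (hC : IsCycleGraph C) :
    Even k ∧ ∏ i ∈ Finset.range k, a (p i) (p (i + 1)) = (-1) ^ (k / 2) := by
  obtain ⟨-, hm, hc⟩ := h.isolate_singleton ha le_rfl hC hp.start_mem_support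
  have hmk := hp.two_mul_matchingNumber_le
  obtain ⟨r, rfl | rfl⟩ := Nat.even_or_odd' k
  · refine ⟨even_two_mul r, ?_⟩
    rw [Nat.mul_div_cancel_left r two_pos]
    by_contra hgain
    have hn := hp.le_negIndex ha hgain
    have hpos := cyclomaticNumber_nonneg (isolate C {p 0})
    unfold IsTight at h
    lia
  · have := hp.le_matchingNumber_isolate (S := {p 0}) (a := 1) (r := r)
      (Set.singleton_subset_iff.2 ⟨0, Nat.one_pos, rfl⟩) (by lia)
    lia

end Tight

section DisjointCycles

variable {V : Type*} {H C : SimpleGraph V}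

/-- The edges of `H` that lie on no cycle, see `not_isBridge_iff_exists_isCycleGraph`. -/
def bridgeGraph (H : SimpleGraph V) : SimpleGraph V where
  Adj u v := H.Adj u v ∧ H.IsBridge s(u, v)
  symm := ⟨fun _ _ h => ⟨h.1.symm, Sym2.eq_swap ▸ h.2⟩⟩
  loopless := ⟨fun _ h => h.1.ne rfl⟩

theorem bridgeGraph_eq_self_iff : bridgeGraph H = H ↔ H.IsAcyclic := by
  rw [isAcyclic_iff_forall_adj_isBridge]
  exact ⟨fun h u v huv => (h.symm.le huv).2,
    fun h => le_antisymm (fun _ _ huv => huv.1) fun _ _ huv => ⟨huv, h huv⟩⟩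

theorem IsCycleGraph.support_subset_cycleVertices (hC : IsCycleGraph C) (hle : C ≤ H) :
    C.support ⊆ H.cycleVertices := fun _ hv => mem_cycleVertices_iff.2 ⟨C, hle, hC, hv⟩

theorem mem_cycleVertices_of_not_isBridge {u v : V} (h : H.Adj u v)
    (hb : ¬ H.IsBridge s(u, v)) : u ∈ H.cycleVertices := by
  obtain ⟨C, hle, hC, huv⟩ := (not_isBridge_iff_exists_isCycleGraph h).1 hb
  exact hC.support_subset_cycleVertices hle ⟨v, huv⟩

theorem cycleVertices_eq_empty (hH : H.IsAcyclic) : H.cycleVertices = ∅ := by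
  refine Set.eq_empty_of_forall_notMem fun v hv => ?_
  obtain ⟨C, hle, hC, u, hu⟩ := mem_cycleVertices_iff.1 hv
  exact hC.not_isBridge hu (isAcyclic_iff_forall_adj_isBridge.1 (hH.anti hle) hu)

namespace DisjointCycles

variable {C' : SimpleGraph V}

theorem le_sdiff_iff (hD : DisjointCycles H) (hC : IsCycleGraph C) (hle : C ≤ H)
    (hC' : IsCycleGraph C') (hle' : C' ≤ H) : C' ≤ H \ C ↔ C' ≠ C := by
  refine ⟨?_, fun hne u v huv => ⟨hle' huv, fun huv' => hne ?_⟩⟩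
  · rintro h rfl
    obtain ⟨u, v, huv⟩ := hC.exists_adj
    exact (h huv).2 huv
  · exact hD C' hle' C hle hC' hC u ⟨v, huv⟩ ⟨v, huv'⟩

theorem le_isolate_singleton_iff (hD : DisjointCycles H) (hC : IsCycleGraph C) (hle : C ≤ H)
    {x : V} (hx : x ∈ C.support) (hC' : IsCycleGraph C') (hle' : C' ≤ H) :
    C' ≤ isolate H {x} ↔ C' ≠ C := by
  rw [le_isolate_iff, and_iff_right hle', Set.disjoint_singleton_right]
  exact ⟨fun h heq => h (heq ▸ hx), fun hne hx' => hne (hD C' hle' C hle hC' hC x hx' hx)⟩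

theorem cycleVertices_eq_sdiff (hD : DisjointCycles H) (hC : IsCycleGraph C) (hle : C ≤ H)
    {H' : SimpleGraph V} (hle' : H' ≤ H)
    (h : ∀ C' ≤ H, IsCycleGraph C' → (C' ≤ H' ↔ C' ≠ C)) :
    H'.cycleVertices = H.cycleVertices \ C.support := by
  ext v
  rw [Set.mem_sdiff, mem_cycleVertices_iff, mem_cycleVertices_iff]
  constructor
  · rintro ⟨C', hC'H', hC', hv⟩
    have hC'H := hC'H'.trans hle'
    exact ⟨⟨C', hC'H, hC', hv⟩,
      fun hvC => (h C' hC'H hC').1 hC'H' (hD C' hC'H C hle hC' hC v hv hvC)⟩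
  · rintro ⟨⟨C', hC'H, hC', hv⟩, hvC⟩
    exact ⟨C', (h C' hC'H hC').2 (fun heq => hvC (heq ▸ hv)), hC', hv⟩

theorem cycleVertices_sdiff (hD : DisjointCycles H) (hC : IsCycleGraph C) (hle : C ≤ H) :
    (H \ C).cycleVertices = H.cycleVertices \ C.support :=
  hD.cycleVertices_eq_sdiff hC hle sdiff_le fun _ hle' hC' => hD.le_sdiff_iff hC hle hC' hle'

theorem cycleVertices_isolate_singleton (hD : DisjointCycles H) (hC : IsCycleGraph C)
    (hle : C ≤ H) {x : V} (hx : x ∈ C.support) :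
    (isolate H {x}).cycleVertices = H.cycleVertices \ C.support :=
  hD.cycleVertices_eq_sdiff hC hle (isolate_le H {x}) fun _ hle' hC' =>
    hD.le_isolate_singleton_iff hC hle hx hC' hle'

theorem bridgeGraph_sdiff_le (hD : DisjointCycles H) (hC : IsCycleGraph C) (hle : C ≤ H) :
    bridgeGraph (H \ C) ≤ bridgeGraph H := by
  refine fun u v ⟨huv, hb⟩ => ⟨huv.1, by_contra fun hn => ?_⟩
  obtain ⟨C', hle', hC', hadj⟩ := (not_isBridge_iff_exists_isCycleGraph huv.1).1 hn
  have hne : C' ≠ C := fun heq => huv.2 (heq ▸ hadj)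
  exact hC'.not_isBridge hadj (hb.anti ((hD.le_sdiff_iff hC hle hC' hle').2 hne))

theorem ncard_cycleVertices [Finite V] (hD : DisjointCycles H) (hC : IsCycleGraph C)
    (hle : C ≤ H) :
    H.cycleVertices.ncard = (H \ C).cycleVertices.ncard + C.support.ncard := by
  rw [hD.cycleVertices_sdiff hC hle]
  exact (Set.ncard_sdiff_add_ncard_of_subset (hC.support_subset_cycleVertices hle)
    (Set.toFinite _)).symm

theorem cyclomaticNumber_le_sdiff_add_one [Finite V] (hD : DisjointCycles H)
    (hC : IsCycleGraph C) (hle : C ≤ H) :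
    H.cyclomaticNumber ≤ (H \ C).cyclomaticNumber + 1 := by
  obtain ⟨x, u, hxu⟩ := hC.exists_adj
  have hb := (not_isBridge_iff_exists_isCycleGraph (hle hxu)).2 ⟨C, hle, hC, hxu⟩
  have hdelete := cyclomaticNumber_deleteEdges_of_not_isBridge (hle hxu) hb
  -- What is left of `C` in `H - xu` consists of bridges, so removing it does not lower `c`.
  have hrest : (H.deleteEdges {s(x, u)}).cyclomaticNumber ≤ (H \ C).cyclomaticNumber := by
    refine cyclomaticNumber_le_of_forall_isBridge
      (le_deleteEdges_singleton sdiff_le fun h => h.2 hxu) fun v w hvw hnot => ?_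
    by_contra hcon
    obtain ⟨C', hle', hC', hadj⟩ := (not_isBridge_iff_exists_isCycleGraph hvw).1 hcon
    have hvwH := deleteEdges_le _ hvw
    have hvwC : C.Adj v w := by_contra fun hc => hnot ⟨hvwH, hc⟩
    obtain rfl := hD C' (hle'.trans (deleteEdges_le _)) C hle hC' hC v ⟨w, hadj⟩ ⟨w, hvwC⟩
    have := hle' hxu
    rw [deleteEdges_adj] at this
    exact this.2 rfl
  lia

end DisjointCycles

theorem IsCycleGraph.sdiff_lt (hC : IsCycleGraph C) (hle : C ≤ H) : H \ C < H := by
  obtain ⟨u, v, huv⟩ := hC.exists_adj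
  exact sdiff_le.lt_of_not_ge fun h => (h (hle huv)).2 huv

theorem IsCycleGraph.exists_perfect_isEdgeMatching (hC : IsCycleGraph C)
    (heven : Even C.support.ncard) :
    ∃ M, IsEdgeMatching C M ∧ (∀ e ∈ M, ∀ v ∈ e, v ∈ C.support) ∧
      2 * M.card = C.support.ncard := by
  obtain ⟨x, u, hxu⟩ := hC.exists_adj
  obtain ⟨k, p, hp, -⟩ := hC.exists_isCycleEnum ⟨u, hxu⟩
  obtain ⟨r, hr⟩ := even_iff_exists_two_mul.1 heven
  obtain rfl : k = 2 * r := hp.ncard_support ▸ hr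
  obtain ⟨M, hM, hcard, hv⟩ := hp.exists_isEdgeMatching_card (a := 0) (r := r) (by lia)
  refine ⟨M, hM, fun e he v hve => ?_, by rw [hcard, hp.ncard_support]⟩
  obtain ⟨i, -, hi, rfl⟩ := hv e he v hve
  exact hp.mem_support_iff.2 ⟨i, by lia, rfl⟩

theorem two_mul_matchingNumber_le_of_isVertexCover_bridgeGraph [Finite V] {K : Finset V}
    (hK : (bridgeGraph H).IsVertexCover K) :
    2 * H.matchingNumber ≤ 2 * K.card + H.cycleVertices.ncard := by
  classical
  have := Fintype.ofFinite V
  obtain ⟨M, hM, hcard⟩ := exists_isEdgeMatching H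
  have hcovered : (M.filter fun e => ∃ v ∈ K, v ∈ e).card ≤ K.card :=
    (hM.subset (Finset.filter_subset _ _)).card_le_of_cover fun e he => (Finset.mem_filter.1 he).2
  have huncovered : 2 * (M.filter fun e => ¬ ∃ v ∈ K, v ∈ e).card ≤ H.cycleVertices.ncard := by
    rw [Set.ncard_eq_toFinset_card']
    refine (hM.subset (Finset.filter_subset _ _)).two_mul_card_le fun e he v hv => ?_
    obtain ⟨he, hn⟩ := Finset.mem_filter.1 he
    obtain ⟨u, rfl⟩ := Sym2.mem_iff_exists.1 hv
    have hvu : H.Adj v u := hM.1 _ he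
    refine Set.mem_toFinset.2 (mem_cycleVertices_of_not_isBridge hvu fun hb => hn ?_)
    exact (hK ⟨hvu, hb⟩).elim (fun h => ⟨v, h, Sym2.mem_mk_left _ _⟩)
      fun h => ⟨u, h, Sym2.mem_mk_right _ _⟩
  have hsplit := Finset.card_filter_add_card_filter_not (s := M) (fun e => ∃ v ∈ K, v ∈ e)
  lia

namespace DisjointCycles

theorem exists_perfect_isEdgeMatching [Finite V] (hD : DisjointCycles H)
    (heven : ∀ C ≤ H, IsCycleGraph C → Even C.support.ncard) :
    ∃ M, IsEdgeMatching H M ∧ (∀ e ∈ M, ∀ v ∈ e, v ∈ H.cycleVertices) ∧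
      2 * M.card = H.cycleVertices.ncard := by
  classical
  induction H using WellFoundedLT.induction with
  | ind H ih =>
    by_cases hH : H.IsAcyclic
    · exact ⟨∅, .empty H, by simp, by simp [cycleVertices_eq_empty hH]⟩
    obtain ⟨C, hle, hC⟩ := exists_isCycleGraph_of_not_isAcyclic hH
    obtain ⟨M, hM, hMC, hMcard⟩ := hC.exists_perfect_isEdgeMatching (heven C hle hC)
    obtain ⟨N, hN, hNv, hNcard⟩ := ih _ (hC.sdiff_lt hle) (hD.mono sdiff_le)
      fun C' hle' => heven C' (hle'.trans sdiff_le)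
    rw [hD.cycleVertices_sdiff hC hle] at hNv
    have hdisj : ∀ e ∈ N, ∀ f ∈ M, ∀ v, v ∈ e → v ∉ f :=
      fun e he f hf v hve hvf => (hNv e he v hve).2 (hMC f hf v hvf)
    refine ⟨N ∪ M, (hN.mono sdiff_le).union (hM.mono hle) hdisj, fun e he v hv => ?_, ?_⟩
    · exact (Finset.mem_union.1 he).elim (fun he => (hNv e he v hv).1)
        fun he => hC.support_subset_cycleVertices hle (hMC e he v hv)
    · rw [IsEdgeMatching.card_union hdisj, hD.ncard_cycleVertices hC hle]
      lia

theorem le_two_mul_matchingNumber [Finite V] (hD : DisjointCycles H)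
    (heven : ∀ C ≤ H, IsCycleGraph C → Even C.support.ncard) :
    2 * (isolate H H.cycleVertices).matchingNumber + H.cycleVertices.ncard ≤
      2 * H.matchingNumber := by
  classical
  obtain ⟨M, hM, hMv, hMcard⟩ := hD.exists_perfect_isEdgeMatching heven
  obtain ⟨N, hN, hNcard⟩ := exists_isEdgeMatching (isolate H H.cycleVertices)
  have hdisj : ∀ e ∈ N, ∀ f ∈ M, ∀ v, v ∈ e → v ∉ f :=
    fun e he f hf v hve hvf => (mem_edgeSet_isolate.1 (hN.1 e he)).2 v hve (hMv f hf v hvf)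
  have hle := ((hN.mono (isolate_le H _)).union hM hdisj).card_le
  rw [IsEdgeMatching.card_union hdisj] at hle
  lia

theorem negIndex_add_cyclomaticNumber_le {𝕜 : Type*} [RCLike 𝕜] [Fintype V] {a : V → V → 𝕜}
    (ha : IsUnitGain a) (hD : DisjointCycles H)
    (hgain : ∀ C ≤ H, IsCycleGraph C → 2 * (negIndex (gainMatrix a C) + 1) ≤ C.support.ncard)
    {K : Finset V} (hK : (bridgeGraph H).IsVertexCover K) :
    2 * (negIndex (gainMatrix a H) : ℤ) + 2 * H.cyclomaticNumber ≤
      2 * K.card + H.cycleVertices.ncard := by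
  induction H using WellFoundedLT.induction with
  | ind H ih =>
    by_cases hH : H.IsAcyclic
    · have hn := negIndex_gainMatrix_le_card_of_isVertexCover a (bridgeGraph_eq_self_iff.2 hH ▸ hK)
      have hc := cyclomaticNumber_le_of_forall_isBridge bot_le
        fun u v huv _ => isAcyclic_iff_forall_adj_isBridge.1 hH huv
      rw [cyclomaticNumber_bot] at hc
      lia
    obtain ⟨C, hle, hC⟩ := exists_isCycleGraph_of_not_isAcyclic hH
    have hih := ih _ (hC.sdiff_lt hle) (hD.mono sdiff_le)
      (fun C' hle' => hgain C' (hle'.trans sdiff_le)) (hK.mono (hD.bridgeGraph_sdiff_le hC hle))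
    have hncard := hD.ncard_cycleVertices hC hle
    have hc := hD.cyclomaticNumber_le_sdiff_add_one hC hle
    have hn := negIndex_gainMatrix_le_sdiff_add ha hle
    have hnC := hgain C hle hC
    lia

end DisjointCycles

end DisjointCycles

section BridgeCover

variable {V : Type*} {H C : SimpleGraph V} {x y : V}

/-- Some vertex set that avoids the cycles of `H` covers the edges of `H` lying on no cycle, and is
no larger than a matching that avoids the cycles. This is condition (c) expressed inside `H`, see
`DisjointCycles.hasBridgeCover_iff`. -/
def HasBridgeCover (H : SimpleGraph V) : Prop :=
  ∃ K : Finset V, Disjoint (K : Set V) H.cycleVertices ∧ (bridgeGraph H).IsVertexCover K ∧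
    K.card ≤ (isolate H H.cycleVertices).matchingNumber

theorem isolate_bridgeGraph_le (H : SimpleGraph V) (S : Set V) :
    isolate (bridgeGraph H) S ≤ bridgeGraph (isolate H S) :=
  fun _ _ h => ⟨⟨h.1.1, h.2⟩, h.1.2.anti (isolate_le H S)⟩

theorem isolate_cycleVertices_le_bridgeGraph (H : SimpleGraph V) :
    isolate H H.cycleVertices ≤ bridgeGraph H :=
  fun _ _ h => ⟨h.1, by_contra fun hb => h.2.1 (mem_cycleVertices_of_not_isBridge h.1 hb)⟩

theorem cycleVertices_isolate_of_disjoint {S : Set V}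
    (h : ∀ C ≤ H, IsCycleGraph C → Disjoint C.support S) :
    (isolate H S).cycleVertices = H.cycleVertices := by
  ext v
  rw [mem_cycleVertices_iff, mem_cycleVertices_iff]
  constructor
  · rintro ⟨C, hle, hC, hv⟩
    exact ⟨C, hle.trans (isolate_le H S), hC, hv⟩
  · rintro ⟨C, hle, hC, hv⟩
    exact ⟨C, le_isolate_iff.2 ⟨hle, h C hle hC⟩, hC, hv⟩

theorem hasBridgeCover_of_forall_not_isBridge (h : ∀ u v, H.Adj u v → ¬ H.IsBridge s(u, v)) :
    HasBridgeCover H :=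
  ⟨∅, by simp, fun u v huv => absurd huv.2 (h u v huv.1), by simp⟩

theorem HasBridgeCover.of_pendant [Finite V] (hxy : H.Adj x y) (hx : ∀ z, H.Adj x z → z = y)
    (hdisj : ∀ C ≤ H, IsCycleGraph C → Disjoint C.support {x, y})
    (h : HasBridgeCover (isolate H {x, y})) : HasBridgeCover H := by
  classical
  obtain ⟨K, hKO, hK, hcard⟩ := h
  rw [cycleVertices_isolate_of_disjoint hdisj] at hKO hcard
  have hO : ∀ v ∈ ({x, y} : Set V), v ∉ H.cycleVertices := by
    intro v hv hvO
    obtain ⟨C, hle, hC, hvC⟩ := mem_cycleVertices_iff.1 hvO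
    exact Set.disjoint_left.1 (hdisj C hle hC) hvC hv
  refine ⟨insert y K, ?_, fun u v huv => ?_, ?_⟩
  · rw [Finset.coe_insert, Set.disjoint_insert_left]
    exact ⟨hO y (by simp), hKO⟩
  · rw [Finset.coe_insert]
    by_cases hy : u = y ∨ v = y
    · exact hy.imp (fun h => Or.inl h) fun h => Or.inl h
    · have hux : u ≠ x := fun h => hy (Or.inr (hx v (h ▸ huv.1)))
      have hvx : v ≠ x := fun h => hy (Or.inl (hx u (h ▸ huv.1.symm)))
      have hadj : (isolate (bridgeGraph H) {x, y}).Adj u v :=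
        ⟨huv, by rintro (h | h) <;> simp_all, by rintro (h | h) <;> simp_all⟩
      exact (hK (isolate_bridgeGraph_le H _ hadj)).imp Or.inr Or.inr
  · have hadj : (isolate H H.cycleVertices).Adj x y := ⟨hxy, hO x (by simp), hO y (by simp)⟩
    have hm := matchingNumber_isolate_pair_add_one_le hadj
    rw [isolate_isolate, Set.union_comm, ← isolate_isolate] at hm
    have := Finset.card_insert_le y K
    lia

theorem hasBridgeCover_of_isAcyclic [Finite V] (hH : H.IsAcyclic) : HasBridgeCover H := by
  induction H using WellFoundedLT.induction with
  | ind H ih =>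
    have hbridge := isAcyclic_iff_forall_adj_isBridge.1 hH
    obtain rfl | hne := eq_or_ne H ⊥
    · exact hasBridgeCover_of_forall_not_isBridge fun _ _ h => h.elim
    obtain ⟨u, v, huv, -⟩ := exists_adj_not_adj_of_lt (bot_lt_iff_ne_bot.2 hne)
    obtain ⟨x, y, hend, -⟩ := exists_isEndBridge huv (hbridge huv)
    refine (ih _ (isolate_lt (S := {x, y}) hend.adj (Set.mem_insert x _))
      (hH.anti (isolate_le H _))).of_pendant hend.adj
      (fun z hz => hend.eq_of_isBridge hz (hbridge hz)) fun C hle hC => ?_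
    have hsub := hC.support_subset_cycleVertices hle
    rw [cycleVertices_eq_empty hH, Set.subset_empty_iff] at hsub
    exact hsub ▸ Set.empty_disjoint _

theorem exists_isVertexCover_card_le_matchingNumber [Finite V] (hH : H.IsAcyclic) :
    ∃ K : Finset V, H.IsVertexCover K ∧ K.card ≤ H.matchingNumber := by
  obtain ⟨K, -, hK, hcard⟩ := hasBridgeCover_of_isAcyclic hH
  rw [bridgeGraph_eq_self_iff.2 hH] at hK
  exact ⟨K, hK, hcard.trans (matchingNumber_mono (isolate_le H _))⟩

/-- A cycle `C` of `H` that only the edge `xy`, with `x` on `C`, can join to the rest of `H`. -/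
structure IsEndCycle (H C : SimpleGraph V) (x y : V) : Prop where
  isCycleGraph : IsCycleGraph C
  le : C ≤ H
  mem_support : x ∈ C.support
  eq_of_adj : ∀ u ∈ C.support, ∀ v ∉ C.support, H.Adj u v → u = x ∧ v = y

theorem IsEndBridge.exists_isEndCycle (hD : DisjointCycles H) (h : IsEndBridge H x y) {z : V}
    (hxz : H.Adj x z) (hzy : z ≠ y) : ∃ C, IsEndCycle H C x y := by
  have hx := mem_edgeSide_self H x y
  obtain ⟨C, hle, hC, hCxz⟩ := (not_isBridge_iff_exists_isCycleGraph hxz).1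
    fun hb => hzy (h.eq_of_isBridge hxz hb)
  have hxC : x ∈ C.support := ⟨z, hCxz⟩
  have hyC : y ∉ C.support := fun hy => hC.not_isBridge_of_mem_support hle hxC hy h.isBridge
  have hCside : ∀ v ∈ C.support, v ∈ edgeSide H x y := fun v hv =>
    (hC.reachable hxC hv).mono (le_deleteEdges_singleton hle fun hadj => hyC ⟨x, hadj.symm⟩)
  refine ⟨C, hC, hle, hxC, fun u hu v hv huv => ?_⟩
  by_contra hne
  have hne' : s(u, v) ≠ s(x, y) := fun he => by
    rcases Sym2.eq_iff.1 he with he | ⟨rfl, -⟩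
    exacts [hne he, hyC hu]
  have hb := h.not_isBridge u v huv (hCside u hu) (mem_edgeSide_of_adj (hCside u hu) huv hne')
  obtain ⟨C', hle', hC', hadj⟩ := (not_isBridge_iff_exists_isCycleGraph huv).1 hb
  obtain rfl := hD C' hle' C hle hC' hC u ⟨v, hadj⟩ hu
  exact hv ⟨u, hadj.symm⟩

namespace IsEndCycle

theorem eq_of_bridgeGraph_adj (h : IsEndCycle H C x y) {u v : V} (hu : u ∈ C.support)
    (huv : (bridgeGraph H).Adj u v) : u = x ∧ v = y := by
  refine h.eq_of_adj u hu v (fun hv => ?_) huv.1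
  exact h.isCycleGraph.not_isBridge_of_mem_support h.le hu hv huv.2

theorem bridgeGraph_le_bridgeGraph_isolate (h : IsEndCycle H C x y) {z : V}
    (hz : z ∈ C.support) (hzx : z ≠ x) : bridgeGraph H ≤ bridgeGraph (isolate H {z}) := by
  have hnot : ∀ v, ¬ (bridgeGraph H).Adj z v := fun v hv => hzx (h.eq_of_bridgeGraph_adj hz hv).1
  refine fun u v huv => isolate_bridgeGraph_le H {z} ⟨huv, ?_, ?_⟩
  · rintro rfl
    exact hnot v huv
  · rintro rfl
    exact hnot u huv.symm

variable [Finite V]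

theorem two_mul_matchingNumber_isolate_le (h : IsEndCycle H C x y) :
    2 * (isolate (isolate H {x}) (H.cycleVertices \ C.support)).matchingNumber + 1 ≤
      2 * (isolate H H.cycleVertices).matchingNumber + C.support.ncard := by
  classical
  have := Fintype.ofFinite V
  have hm := two_mul_matchingNumber_le_isolate_add
    (G := isolate (isolate H {x}) (H.cycleVertices \ C.support))
    (S := C.support) (K := C.support.toFinset.erase x) fun u v huv hu => by
      have hv : v ∈ C.support := by_contra fun hv => huv.1.2.1 (h.eq_of_adj u hu v hv huv.1.1).1
      simp only [Finset.mem_erase, Set.mem_toFinset]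
      exact ⟨⟨huv.1.2.1, hu⟩, huv.1.2.2, hv⟩
  have hle : isolate (isolate (isolate H {x}) (H.cycleVertices \ C.support)) C.support ≤
      isolate H H.cycleVertices := fun u v huv =>
    ⟨huv.1.1.1, fun hu => huv.1.2.1 ⟨hu, huv.2.1⟩, fun hv => huv.1.2.2 ⟨hv, huv.2.2⟩⟩
  have hmono := matchingNumber_mono hle
  have hcard := Finset.card_erase_add_one (Set.mem_toFinset.2 h.mem_support)
  rw [← Set.ncard_eq_toFinset_card'] at hcard
  lia

end IsEndCycle

end BridgeCover

section TightBridgeCover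

variable {V : Type*} {H C : SimpleGraph V} {x y : V}

theorem DisjointCycles.isolate_singleton_le_bridgeGraph (hD : DisjointCycles H)
    (hC : IsCycleGraph C) (hle : C ≤ H) (hx : x ∈ C.support) :
    isolate C {x} ≤ bridgeGraph (isolate H {x}) := by
  refine fun u v huv => ⟨⟨hle huv.1, huv.2⟩, by_contra fun hb => ?_⟩
  have hu := mem_cycleVertices_of_not_isBridge (H := isolate H {x}) ⟨hle huv.1, huv.2⟩ hb
  rw [hD.cycleVertices_isolate_singleton hC hle hx] at hu
  exact hu.2 ⟨v, huv.1⟩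

variable {p : ℕ → V} {r : ℕ} {K : Finset V}

theorem DisjointCycles.le_card_cover_erase_add_one [Finite V] [DecidableEq V]
    [DecidablePred (· ∈ C.support)] (hD : DisjointCycles H) (hC : IsCycleGraph C) (hle : C ≤ H)
    (hp : IsCycleEnum C (2 * r) p) (hpx : p 0 = x)
    (hK : (bridgeGraph (isolate H {p 1})).IsVertexCover K) :
    r ≤ ((K.filter (· ∈ C.support)).erase x).card + 1 := by
  have := hp.three_le
  have hp₁ : p 1 ∈ C.support := hp.mem_support_iff.2 ⟨1, by lia, rfl⟩
  have hpath : r - 1 ≤ (isolate C {x, p 1}).matchingNumber := by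
    refine hp.le_matchingNumber_isolate (a := 2) ?_ (by lia)
    rintro v (rfl | rfl)
    exacts [⟨0, by simp, hpx⟩, ⟨1, by simp, rfl⟩]
  have hcover : (isolate C {x, p 1}).IsVertexCover ((K.filter (· ∈ C.support)).erase x) := by
    rintro u v ⟨huv, hu, hv⟩
    rw [Set.mem_insert_iff, not_or] at hu hv
    have hbridge := hD.isolate_singleton_le_bridgeGraph hC hle hp₁ ⟨huv, hu.2, hv.2⟩
    simp only [Finset.mem_coe, Finset.mem_erase, Finset.mem_filter]
    exact (hK hbridge).imp (fun huK => ⟨hu.1, huK, v, huv⟩) fun hvK => ⟨hv.1, hvK, u, huv.symm⟩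
  have := matchingNumber_le_card_of_isVertexCover hcover
  lia

theorem IsEndCycle.hasBridgeCover_of_card_le [Finite V] (h : IsEndCycle H C x y)
    (hD : DisjointCycles H) (hp : IsCycleEnum C (2 * r) p) (hpx : p 0 = x)
    (hKO : Disjoint (K : Set V) (H.cycleVertices \ C.support))
    (hK : (bridgeGraph (isolate H {p 1})).IsVertexCover K)
    (hcard : K.card + 1 ≤ (isolate H H.cycleVertices).matchingNumber + r) :
    HasBridgeCover H := by
  classical
  have := hp.three_le
  have hp₁ : p 1 ∈ C.support := hp.mem_support_iff.2 ⟨1, by lia, rfl⟩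
  have hp₁x : p 1 ≠ x := fun he =>
    one_ne_zero (hp.injOn (by simp; lia) (by simp; lia) (he.trans hpx.symm))
  have hKH := hK.mono (h.bridgeGraph_le_bridgeGraph_isolate hp₁ hp₁x)
  have hinner := hD.le_card_cover_erase_add_one h.isCycleGraph h.le hp hpx hK
  have houter : (isolate H H.cycleVertices).matchingNumber ≤ (K.filter (· ∉ C.support)).card := by
    refine matchingNumber_le_card_of_isVertexCover fun u v huv => ?_
    have hC := h.isCycleGraph.support_subset_cycleVertices h.le
    simp only [Finset.mem_coe, Finset.mem_filter]
    exact (hKH (isolate_cycleVertices_le_bridgeGraph H huv)).imp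
      (fun hu => ⟨hu, fun huC => huv.2.1 (hC huC)⟩) fun hv => ⟨hv, fun hvC => huv.2.2 (hC hvC)⟩
  have hsplit := K.card_filter_add_card_filter_not (· ∈ C.support)
  have hx : x ∉ K := fun hx => by
    have := Finset.card_erase_add_one (Finset.mem_filter.2 ⟨hx, h.mem_support⟩)
    lia
  refine ⟨K.filter (· ∉ C.support), ?_, fun u v huv => ?_, ?_⟩
  · refine Set.disjoint_left.2 fun v hv hvO => ?_
    rw [Finset.mem_coe, Finset.mem_filter] at hv
    exact Set.disjoint_left.1 hKO hv.1 ⟨hvO, hv.2⟩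
  · have hside : ∀ {u v}, (bridgeGraph H).Adj u v → u ∈ K → u ∈ C.support → False :=
      fun huv huK huC => hx ((h.eq_of_bridgeGraph_adj huC huv).1 ▸ huK)
    simp only [Finset.mem_coe, Finset.mem_filter]
    exact (hKH huv).imp (fun hu => ⟨hu, hside huv hu⟩) fun hv => ⟨hv, hside huv.symm hv⟩
  · have := Finset.card_erase_le (s := K.filter (· ∈ C.support)) (a := x)
    lia

variable {𝕜 : Type*} [RCLike 𝕜] [Fintype V] {a : V → V → 𝕜}

theorem IsTight.even_ncard_support (ha : IsUnitGain a) (h : IsTight a H) (hC : IsCycleGraph C)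
    (hle : C ≤ H) : Even C.support.ncard := by
  obtain ⟨u, v, huv⟩ := hC.exists_adj
  obtain ⟨k, p, hp, -⟩ := hC.exists_isCycleEnum ⟨v, huv⟩
  rw [hp.ncard_support]
  exact ((h.of_isCycleGraph_le ha hC hle).gain_eq_of_isCycleEnum ha hp hC).1

theorem IsEndCycle.hasBridgeCover_of_isTight (hxy : IsEndCycle H C x y) (ha : IsUnitGain a)
    (h : IsTight a H) (ih : ∀ z ∈ C.support, HasBridgeCover (isolate H {z})) :
    HasBridgeCover H := by
  have hD := h.disjointCycles ha
  have hC := hxy.isCycleGraph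
  obtain ⟨k, p, hp, hpx⟩ := hC.exists_isCycleEnum hxy.mem_support
  have heven := hp.ncard_support ▸ h.even_ncard_support ha hC hxy.le
  obtain ⟨r, rfl⟩ := heven.two_dvd
  have hthree := hp.three_le
  have hp₁ : p 1 ∈ C.support := hp.mem_support_iff.2 ⟨1, by lia, rfl⟩
  obtain ⟨htight, hm₁, -⟩ := h.isolate_singleton ha hxy.le hC hp₁
  have hm₀ := (h.isolate_singleton ha hxy.le hC hxy.mem_support).2.1
  obtain ⟨K, hKO, hK, hKcard⟩ := ih (p 1) hp₁
  obtain ⟨K₀, -, hK₀, hK₀card⟩ := ih x hxy.mem_support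
  have hlower := (htight.disjointCycles ha).le_two_mul_matchingNumber fun _ hle hC =>
    htight.even_ncard_support ha hC hle
  have hupper := two_mul_matchingNumber_le_of_isVertexCover_bridgeGraph hK₀
  rw [hD.cycleVertices_isolate_singleton hC hxy.le hp₁] at hKO hKcard hlower
  rw [hD.cycleVertices_isolate_singleton hC hxy.le hxy.mem_support] at hK₀card hupper
  have hend := hxy.two_mul_matchingNumber_isolate_le
  rw [hp.ncard_support] at hend
  exact hxy.hasBridgeCover_of_card_le hD hp hpx hKO hK (by lia)

theorem IsTight.hasBridgeCover (ha : IsUnitGain a) (h : IsTight a H) : HasBridgeCover H := by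
  induction H using WellFoundedLT.induction with
  | ind H ih =>
    by_cases hbridge : ∃ u v, H.Adj u v ∧ H.IsBridge s(u, v)
    swap
    · push Not at hbridge
      exact hasBridgeCover_of_forall_not_isBridge hbridge
    obtain ⟨u, v, huv, hb⟩ := hbridge
    obtain ⟨x, y, hend, -⟩ := exists_isEndBridge huv hb
    by_cases hx : ∀ z, H.Adj x z → z = y
    · obtain ⟨htight, hdisj⟩ := h.isolate_pendant ha hend.adj hx
      exact (ih _ (isolate_lt hend.adj (Set.mem_insert x _)) htight).of_pendant hend.adj hx hdisj
    · push Not at hx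
      obtain ⟨z, hxz, hzy⟩ := hx
      obtain ⟨C, hC⟩ := hend.exists_isEndCycle (h.disjointCycles ha) hxz hzy
      refine hC.hasBridgeCover_of_isTight ha h fun w ⟨t, hwt⟩ => ?_
      exact ih _ (isolate_lt (hC.le hwt) rfl)
        (h.isolate_singleton ha hC.le hC.isCycleGraph ⟨t, hwt⟩).1

end TightBridgeCover

section CycleContraction

variable {V : Type*} {G : SimpleGraph V} {u v : V}

/-- The projection of `V(G)` onto `V(T_G)`. -/
def cycleClass (G : SimpleGraph V) : V → Quot G.OnCommonCycle := Quot.mk _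

theorem exists_bridgeGraph_adj_of_cycleContraction_adj {q r : Quot G.OnCommonCycle}
    (h : G.cycleContraction.Adj q r) :
    ∃ u v, (bridgeGraph G).Adj u v ∧ cycleClass G u = q ∧ cycleClass G v = r := by
  obtain ⟨hne, u, v, huv, rfl, rfl⟩ := h
  refine ⟨u, v, ⟨huv, by_contra fun hb => hne (Quot.sound (onCommonCycle_iff.2 ?_))⟩, rfl, rfl⟩
  obtain ⟨C, hle, hC, hadj⟩ := (not_isBridge_iff_exists_isCycleGraph huv).1 hb
  exact ⟨C, hle, hC, ⟨v, hadj⟩, ⟨u, hadj.symm⟩⟩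

namespace DisjointCycles

theorem eq_or_onCommonCycle_of_cycleClass_eq (hD : DisjointCycles G)
    (h : cycleClass G u = cycleClass G v) : u = v ∨ G.OnCommonCycle u v := by
  simp only [onCommonCycle_iff]
  unfold cycleClass at h
  rw [Quot.eq] at h
  induction h with
  | rel u v h => exact Or.inr (onCommonCycle_iff.1 h)
  | refl u => exact Or.inl rfl
  | symm u v _ ih =>
    rcases ih with rfl | ⟨C, hle, hC, hu, hv⟩
    exacts [Or.inl rfl, Or.inr ⟨C, hle, hC, hv, hu⟩]
  | trans u v w _ _ ih ih' =>
    rcases ih with rfl | ⟨C, hle, hC, hu, hv⟩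
    · exact ih'
    rcases ih' with rfl | ⟨C', hle', hC', hv', hw⟩
    · exact Or.inr ⟨C, hle, hC, hu, hv⟩
    · obtain rfl := hD C hle C' hle' hC hC' v hv hv'
      exact Or.inr ⟨C, hle, hC, hu, hw⟩

theorem eq_of_cycleClass_eq (hD : DisjointCycles G) (hu : u ∉ G.cycleVertices)
    (h : cycleClass G u = cycleClass G v) : u = v := by
  refine (hD.eq_or_onCommonCycle_of_cycleClass_eq h).resolve_right fun h => hu ?_
  obtain ⟨C, hle, hC, huC, -⟩ := onCommonCycle_iff.1 h
  exact hC.support_subset_cycleVertices hle huC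

theorem injOn_cycleClass (hD : DisjointCycles G) :
    Set.InjOn (cycleClass G) G.cycleVerticesᶜ :=
  fun _ hu _ _ h => hD.eq_of_cycleClass_eq hu h

theorem cycleContraction_adj_of_bridgeGraph_adj (hD : DisjointCycles G)
    (h : (bridgeGraph G).Adj u v) :
    G.cycleContraction.Adj (cycleClass G u) (cycleClass G v) := by
  refine ⟨fun heq => ?_, u, v, h.1, rfl, rfl⟩
  rcases hD.eq_or_onCommonCycle_of_cycleClass_eq heq with heq | hcommon
  · exact h.1.ne heq
  · obtain ⟨C, hle, hC, hu, hv⟩ := onCommonCycle_iff.1 hcommon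
    exact hC.not_isBridge_of_mem_support hle hu hv h.2

theorem reachable_deleteEdges_of_cycleClass_eq (hD : DisjointCycles G) {x y : V}
    (hb : G.IsBridge s(x, y)) (h : cycleClass G u = cycleClass G v) :
    (G.deleteEdges {s(x, y)}).Reachable u v := by
  rcases hD.eq_or_onCommonCycle_of_cycleClass_eq h with rfl | hcommon
  · exact Reachable.refl _
  · obtain ⟨C, hle, hC, hu, hv⟩ := onCommonCycle_iff.1 hcommon
    exact (hC.reachable hu hv).mono
      (le_deleteEdges_singleton hle fun hadj => hC.not_isBridge hadj (hb.anti hle))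

theorem isAcyclic_cycleContraction (hD : DisjointCycles G) : G.cycleContraction.IsAcyclic := by
  refine isAcyclic_iff_forall_adj_isBridge.2 fun q r h => ?_
  obtain ⟨u, v, ⟨-, hb⟩, rfl, rfl⟩ := exists_bridgeGraph_adj_of_cycleContraction_adj h
  intro hreach
  refine hb (mem_of_reachable_of_forall_adj
    (S := {q | ∀ b, cycleClass G b = q → (G.deleteEdges {s(u, v)}).Reachable u b}) hreach
    (fun b hub => hD.reachable_deleteEdges_of_cycleClass_eq hb hub.symm) ?_ v rfl)
  intro q hq r hqr b hrb
  obtain ⟨⟨-, c, d, hcd, rfl, rfl⟩, hne⟩ := deleteEdges_adj.1 hqr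
  have hcd' : (G.deleteEdges {s(u, v)}).Adj c d :=
    deleteEdges_adj.2 ⟨hcd, fun he => hne (congrArg (Sym2.map (cycleClass G)) he)⟩
  exact ((hq c rfl).trans hcd'.reachable).trans
    (hD.reachable_deleteEdges_of_cycleClass_eq hb hrb.symm)

variable [Finite V]

theorem matchingNumber_isolate_le_cycleContraction (hD : DisjointCycles G) :
    (isolate G G.cycleVertices).matchingNumber ≤ G.cycleContraction.matchingNumber := by
  classical
  refine matchingNumber_le fun M hM => ?_
  have havoid : ∀ e ∈ M, ∀ v ∈ e, v ∈ G.cycleVerticesᶜ := fun e he =>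
    (mem_edgeSet_isolate.1 (hM.1 e he)).2
  rw [← hM.card_image havoid hD.injOn_cycleClass]
  refine (hM.image havoid hD.injOn_cycleClass fun u v huv => ?_).card_le
  exact hD.cycleContraction_adj_of_bridgeGraph_adj
    (isolate_cycleVertices_le_bridgeGraph G (hM.1 _ huv))

end DisjointCycles

theorem HasBridgeCover.matchingNumber_cycleContraction_le [Finite V] (h : HasBridgeCover G) :
    G.cycleContraction.matchingNumber ≤ (isolate G G.cycleVertices).matchingNumber := by
  classical
  obtain ⟨K, -, hK, hcard⟩ := h
  have hcover : G.cycleContraction.IsVertexCover (K.image (cycleClass G)) := by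
    intro q r hqr
    obtain ⟨u, v, huv, rfl, rfl⟩ := exists_bridgeGraph_adj_of_cycleContraction_adj hqr
    exact (hK huv).imp (Finset.mem_image_of_mem _) (Finset.mem_image_of_mem _)
  exact ((matchingNumber_le_card_of_isVertexCover hcover).trans Finset.card_image_le).trans hcard

theorem DisjointCycles.hasBridgeCover_of_matchingNumber_cycleContraction_le [Finite V]
    (hD : DisjointCycles G)
    (h : G.cycleContraction.matchingNumber ≤ (isolate G G.cycleVertices).matchingNumber) :
    HasBridgeCover G := by
  classical
  have := Fintype.ofFinite V
  obtain ⟨L, hL, hLcard⟩ :=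
    exists_isVertexCover_card_le_matchingNumber hD.isAcyclic_cycleContraction
  let K : Finset V := {v | v ∉ G.cycleVertices ∧ cycleClass G v ∈ L}
  have hmem : ∀ {v}, v ∈ K ↔ v ∉ G.cycleVertices ∧ cycleClass G v ∈ L := by simp [K]
  have hcover : (bridgeGraph G).IsVertexCover {v | cycleClass G v ∈ L} := fun u v huv =>
    hL (hD.cycleContraction_adj_of_bridgeGraph_adj huv)
  have hK : (isolate G G.cycleVertices).IsVertexCover K := fun u v huv =>
    (hcover (isolate_cycleVertices_le_bridgeGraph G huv)).imp
      (fun hu => hmem.2 ⟨huv.2.1, hu⟩) fun hv => hmem.2 ⟨huv.2.2, hv⟩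
  have hKcard := matchingNumber_le_card_of_isVertexCover hK
  have himage : (K.image (cycleClass G)).card = K.card :=
    Finset.card_image_of_injOn fun u hu v _ huv => hD.eq_of_cycleClass_eq (hmem.1 hu).1 huv
  have hL_eq : K.image (cycleClass G) = L :=
    Finset.eq_of_subset_of_card_le (Finset.image_subset_iff.2 fun v hv => (hmem.1 hv).2) (by lia)
  have hKL : {v | cycleClass G v ∈ L} ⊆ (K : Set V) := by
    intro u (hu : cycleClass G u ∈ L)
    obtain ⟨v, hv, hvu⟩ := Finset.mem_image.1 (hL_eq ▸ hu)
    exact hD.eq_of_cycleClass_eq (hmem.1 hv).1 hvu ▸ hv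
  refine ⟨K, Set.disjoint_left.2 fun v hv => (hmem.1 hv).1, hcover.subset hKL, ?_⟩
  rw [← himage, hL_eq]
  lia

theorem DisjointCycles.hasBridgeCover_iff [Finite V] (hD : DisjointCycles G) :
    HasBridgeCover G ↔
      G.cycleContraction.matchingNumber = (isolate G G.cycleVertices).matchingNumber :=
  ⟨fun h => le_antisymm h.matchingNumber_cycleContraction_le
      hD.matchingNumber_isolate_le_cycleContraction,
    fun h => hD.hasBridgeCover_of_matchingNumber_cycleContraction_le h.le⟩

end CycleContraction

namespace UnitGainGraph

variable {V : Type*} (Φ : UnitGainGraph V)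

open Classical in
/-- The gain function of `Φ` on all pairs of vertices; the value `1` at nonadjacent pairs plays no
role. -/
noncomputable def totalGain (u v : V) : ℂ :=
  if h : Φ.graph.Adj u v then (Φ.gain ⟨(u, v), h⟩ : ℂ) else 1

theorem isUnitGain_totalGain : IsUnitGain Φ.totalGain where
  star_eq u v := by
    by_cases h : Φ.graph.Adj u v
    · have hsymm : Φ.gain ⟨(v, u), h.symm⟩ = (Φ.gain ⟨(u, v), h⟩)⁻¹ := Φ.gain_symm ⟨(u, v), h⟩
      rw [totalGain, totalGain, dif_pos h, dif_pos h.symm, hsymm, Circle.coe_inv_eq_conj]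
      rfl
    · rw [totalGain, totalGain, dif_neg h, dif_neg fun h' => h h'.symm, star_one]
  norm_eq u v := by
    by_cases h : Φ.graph.Adj u v
    · rw [totalGain, dif_pos h, Circle.norm_coe]
    · rw [totalGain, dif_neg h, norm_one]

theorem gainMatrix_totalGain : gainMatrix Φ.totalGain Φ.graph = Φ.adjMatrix := by
  ext u v
  by_cases h : Φ.graph.Adj u v
  · simp [gainMatrix_apply_of_adj _ h, adjMatrix, totalGain, h]
  · simp [gainMatrix_apply_of_not_adj _ h, adjMatrix, h]

theorem negInertia_eq_negIndex [Fintype V] [DecidableEq V] :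
    Φ.negInertia = negIndex (gainMatrix Φ.totalGain Φ.graph) := by
  rw [gainMatrix_totalGain, negIndex_eq_card_eigenvalues_neg Φ.adjMatrix_isHermitian, negInertia,
    Nat.card_eq_fintype_card]

theorem coe_walkGain {u v : V} (w : Φ.graph.Walk u v) :
    (Φ.walkGain w : ℂ) =
      ∏ i ∈ Finset.range w.length, Φ.totalGain (w.getVert i) (w.getVert (i + 1)) := by
  induction w with
  | nil => simp [walkGain]
  | cons h w ih =>
    rw [Walk.length_cons, Finset.prod_range_succ']
    simp only [Walk.getVert_cons_succ, Walk.getVert_zero]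
    rw [← ih, walkGain, walkGain, Walk.darts_cons, List.map_cons, List.prod_cons, Circle.coe_mul,
      mul_comm, totalGain, dif_pos h]

variable {Φ}

theorem cyclesTypeA_of_isTight [Fintype V] (h : IsTight Φ.totalGain Φ.graph) :
    Φ.CyclesTypeA := by
  intro v w hw
  have ha := Φ.isUnitGain_totalGain
  have hC := IsCycleGraph.of_isCycle hw
  rw [IsTypeA, coe_walkGain]
  exact (h.of_isCycleGraph_le ha hC w.toSubgraph.spanningCoe_le).gain_eq_of_isCycleEnum ha
    (.of_isCycle hw) hC

namespace CyclesTypeA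

variable {C : SimpleGraph V}

theorem even_ncard_support (h : Φ.CyclesTypeA) (hC : IsCycleGraph C) (hle : C ≤ Φ.graph) :
    Even C.support.ncard := by
  obtain ⟨x, w, hw, rfl⟩ := hC.exists_walk hle
  rw [(IsCycleEnum.of_isCycle hw).ncard_support]
  exact (h x w hw).1

theorem two_mul_negIndex_add_one_le [Fintype V] (h : Φ.CyclesTypeA) (hC : IsCycleGraph C)
    (hle : C ≤ Φ.graph) :
    2 * (negIndex (gainMatrix Φ.totalGain C) + 1) ≤ C.support.ncard := by
  obtain ⟨x, w, hw, rfl⟩ := hC.exists_walk hle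
  obtain ⟨heven, hgain⟩ := h x w hw
  have henum := IsCycleEnum.of_isCycle hw
  rw [henum.ncard_support]
  rw [coe_walkGain] at hgain
  obtain ⟨r, hr⟩ := heven.two_dvd
  rw [hr] at henum hgain ⊢
  rw [Nat.mul_div_cancel_left r two_pos] at hgain
  exact Nat.mul_le_mul_left 2 (henum.negIndex_add_one_le Φ.isUnitGain_totalGain hgain)

end CyclesTypeA

end UnitGainGraph

theorem theorem3p11_general {V : Type*} [Fintype V] [DecidableEq V] (Φ : UnitGainGraph V) :
    (Φ.negInertia : ℤ) = (Φ.graph.matchingNumber : ℤ) - Φ.graph.cyclomaticNumber ↔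
      Φ.graph.CyclesVertexDisjoint ∧
      Φ.CyclesTypeA ∧
      Φ.graph.cycleContraction.matchingNumber =
        (Φ.graph.induce (Φ.graph.cycleVertices)ᶜ).matchingNumber := by
  have ha := Φ.isUnitGain_totalGain
  have hbound := matchingNumber_le_negIndex_add_cyclomaticNumber ha Φ.graph
  rw [Φ.negInertia_eq_negIndex, matchingNumber_induce_compl, cyclesVertexDisjoint_iff]
  constructor
  · intro h
    have htight : IsTight Φ.totalGain Φ.graph := by
      rw [IsTight, h, sub_add_cancel]
    have hD := htight.disjointCycles ha
    exact ⟨hD, UnitGainGraph.cyclesTypeA_of_isTight htight,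
      hD.hasBridgeCover_iff.1 (htight.hasBridgeCover ha)⟩
  · rintro ⟨hD, hA, hcontract⟩
    obtain ⟨K, -, hK, hcard⟩ := hD.hasBridgeCover_iff.2 hcontract
    have hupper := hD.negIndex_add_cyclomaticNumber_le ha
      (fun _ hle hC => hA.two_mul_negIndex_add_one_le hC hle) hK
    have hlower := hD.le_two_mul_matchingNumber fun _ hle hC => hA.even_ncard_support hC hle
    lia

theorem theorem3p11 {V : Type*} [Fintype V] [DecidableEq V] (Φ : UnitGainGraph V)
    (hconn : Φ.graph.Connected) :
    (Φ.negInertia : ℤ) = (Φ.graph.matchingNumber : ℤ) - Φ.graph.cyclomaticNumber ↔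
      Φ.graph.CyclesVertexDisjoint ∧
      Φ.CyclesTypeA ∧
      Φ.graph.cycleContraction.matchingNumber =
        (Φ.graph.induce (Φ.graph.cycleVertices)ᶜ).matchingNumber :=
  theorem3p11_general Φ
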